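/- Let $p>2$, $H\ge 1$ and $P,L\ge 0$ be fixed. For $\ell>0$ let $\mathcal G=\mathcal G_\ell$ be the regular single-knot metric graph of length $\ell$, that is, the metric graph consisting of $H$ half-lines $[0,\infty)$, $P$ pendants (edges $[0,\ell]$) and $L$ loops of length $2\ell$, all attached at a single vertex $\mathbf 0$. A dummy vertex is placed at the midpoint of each loop, so that each loop consists of two compact edges; every compact edge is then identified with $[0,\ell]$ and every half-line with $[0,\infty)$, the vertex $\mathbf 0$ being at $x=0$. For $u:\mathcal G\to\mathbb R$, $u_e$ denotes the restriction of $u$ to the edge $e$. Let $H^1(\mathcal G)$ be the space of continuous $u:\mathcal G\to\mathbb R$ such that $u_e\in H^1$ for every edge $e$. A bound-state is a function $u\in H^1(\mathcal G)$, $u\not\equiv 0$, with $$\int_{\mathcal G} u'\eta'+u\eta-|u|^{p-2}u\eta\,dx=0\qquad\text{for all }\eta\in H^1(\mathcal G),$$ and its action is $$S(u)=\frac12\int_{\mathcal G}\bigl(|u'|^2+|u|^2\bigr)dx-\frac1p\int_{\mathcal G}|u|^p\,dx .$$ Let $$\varphi(x)=\Bigl(\frac p2\Bigr)^{\frac1{p-2}}\operatorname{sech}^{\frac2{p-2}}\Bigl(\frac{p-2}2x\Bigr),\qquad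 x\in\mathbb R,$$ be the real-line soliton, and let $S(\varphi)$ be its action on $\mathbb R$, defined by the same formula with $\mathcal G$ replaced by $\mathbb R$. **Theorem.** Let $0\le P_0\le P$ and $0\le L_0\le L$ be such that $E_0:=P_0+2L_0>0$, and let $\mathcal G_0$ be a subgraph of $\mathcal G$ consisting of $P_0$ pendants and $L_0$ loops (the same pendants and loops for every $\ell$). There is a constant $C>0$, independent of $\epsilon$ and $\ell$, such that for every $\epsilon>0$ there is $\ell_0>0$ such that for every $\ell\ge\ell_0$ there exists a bound-state $v$ on $\mathcal G_\ell$ with the following properties. 1. $0<v(\mathbf 0)<\epsilon$. 2. $v$ is core-symmetric in $\mathcal G_0$ and in $\mathcal G\setminus\mathcal G_0$: $v_{\kappa_1}=v_{\kappa_2}$ on $[0,\ell]$ whenever $\kappa_1,\kappa_2$ are two compact edges both in $\mathcal G_0$, or both not in $\mathcal G_0$. 3. For each compact edge $\kappa\notin\mathcal G_0$, $v_\kappa$ is strictly decreasing on $[0,\ell]$ and $\|v_\kappa\|_{L^\infty(0,\ell)}<\epsilon$. 4. For each compact edge $\kappa\in\mathcal G_0$, $\|v_\kappa-\varphi(\ell-\cdot)\|_{L^\infty(0,\ell)}\le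 C\epsilon$. 5. For each half-line $h$, $v_h$ is strictly decreasing on $[0,\infty)$. 6. $\bigl|S(v)-\tfrac{E_0}2S(\varphi)\bigr|\le C\epsilon$. -/

import Mathlib

open MeasureTheory Set
open scoped ContDiff

noncomputable section

/-- `g` is the weak derivative of `u` in the interior of the interval `I`. -/
def IsWeakDeriv (I : Set ℝ) (u g : ℝ → ℝ) : Prop :=
  ∀ ψ : ℝ → ℝ, ContDiff ℝ ∞ ψ → HasCompactSupport ψ → tsupport ψ ⊆ interior I →
    ∫ x in I, u x * deriv ψ x = -∫ x in I, g x * ψ x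

/-- The Sobolev space `H¹(I)` of an interval `I`: square integrable functions that have a square
integrable weak derivative. -/
def MemH1Interval (I : Set ℝ) (u : ℝ → ℝ) : Prop :=
  MemLp u 2 (volume.restrict I) ∧
    ∃ g : ℝ → ℝ, MemLp g 2 (volume.restrict I) ∧ IsWeakDeriv I u g

open Classical in
/-- The (almost everywhere unique) square integrable weak derivative of a function in `H¹(I)`. -/
def weakDeriv (I : Set ℝ) (u : ℝ → ℝ) : ℝ → ℝ :=
  if h : ∃ g : ℝ → ℝ, MemLp g 2 (volume.restrict I) ∧ IsWeakDeriv I u g then h.choose else 0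

/-- A single-knot metric graph with `H` half-lines, `P` pendants and `L` loops, all of them attached
at one vertex `0`, is given by the lengths of its pendants and of its loops. -/
structure SingleKnotGraph (H P L : ℕ) where
  pendantLength : Fin P → ℝ
  loopLength : Fin L → ℝ
  pendantLength_pos : ∀ i, 0 < pendantLength i
  loopLength_pos : ∀ i, 0 < loopLength i

/-- The edges of a single-knot graph. -/
inductive KnotEdge (H P L : ℕ) : Type
  | halfLine (h : Fin H) : KnotEdge H P L
  | pendant (i : Fin P) : KnotEdge H P L
  | loop (i : Fin L) : KnotEdge H P L
  deriving Fintype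

/-- The compact edges of a single-knot graph after a dummy vertex has been put at the midpoint of
each loop: a pendant is one edge, a loop consists of two edges. -/
inductive CoreEdge (P L : ℕ) : Type
  | pendant (i : Fin P) : CoreEdge P L
  | loopHalf (i : Fin L) (side : Bool) : CoreEdge P L

/-- The compact edges that belong to the subgraph made of the pendants in `A` and the loops
in `B`. -/
def coreEdgesOf {P L : ℕ} (A : Finset (Fin P)) (B : Finset (Fin L)) : Set (CoreEdge P L) :=
  {κ | match κ with
    | .pendant i => i ∈ A
    | .loopHalf i _ => i ∈ B}

namespace SingleKnotGraph

variable {H P L : ℕ}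

/-- The graph is regular of length `ℓ`. -/
def IsRegular (G : SingleKnotGraph H P L) (ℓ : ℝ) : Prop :=
  (∀ i, G.pendantLength i = ℓ) ∧ ∀ i, G.loopLength i = 2 * ℓ

/-- The interval with which an edge is identified. The vertex `0` is at `x = 0`; on a loop it is
also at the right endpoint. -/
def dom (G : SingleKnotGraph H P L) : KnotEdge H P L → Set ℝ
  | .halfLine _ => Ici 0
  | .pendant i => Icc 0 (G.pendantLength i)
  | .loop i => Icc 0 (G.loopLength i)

/-- A real function on the graph: its value at the vertex `0` and its restrictions to the edges,
which take that value at the vertex. Only the values of `edge e` on `G.dom e` are meaningful. -/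
structure Func (G : SingleKnotGraph H P L) where
  vertex : ℝ
  edge : KnotEdge H P L → ℝ → ℝ
  edge_zero : ∀ e, edge e 0 = vertex
  loop_end : ∀ i, edge (.loop i) (G.loopLength i) = vertex

variable {G : SingleKnotGraph H P L}

/-- The restriction of `u` to a compact edge, where the vertex `0` is at `x = 0`. The second half of
a loop is traversed backwards, from the vertex `0` to the dummy vertex at the midpoint. -/
def Func.core (u : G.Func) : CoreEdge P L → ℝ → ℝ
  | .pendant i => u.edge (.pendant i)
  | .loopHalf i false => u.edge (.loop i)
  | .loopHalf i true => fun x => u.edge (.loop i) (G.loopLength i - x)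

/-- The space `H¹(G)`: continuous functions on the graph that are in `H¹` on every edge. -/
def Func.MemH1 (u : G.Func) : Prop :=
  ∀ e, ContinuousOn (u.edge e) (G.dom e) ∧ MemH1Interval (G.dom e) (u.edge e)

/-- A bound-state of the nonlinear Schrödinger equation `-u'' + u = |u|^(p-2) u` on the graph: a
nontrivial weak solution in `H¹(G)`. -/
def Func.IsBoundState (p : ℝ) (u : G.Func) : Prop :=
  u.MemH1 ∧ (∃ e, ∃ x ∈ G.dom e, u.edge e x ≠ 0) ∧
    ∀ η : G.Func, η.MemH1 →
      ∑ e, ∫ x in G.dom e,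
        (weakDeriv (G.dom e) (u.edge e) x * weakDeriv (G.dom e) (η.edge e) x
          + u.edge e x * η.edge e x
          - |u.edge e x| ^ (p - 2) * u.edge e x * η.edge e x) = 0

/-- Core symmetry on a set `K` of compact edges of a regular graph of length `ℓ`: all the
restrictions to edges of `K` coincide. -/
def Func.CoreSymmetricOn (u : G.Func) (ℓ : ℝ) (K : Set (CoreEdge P L)) : Prop :=
  ∀ κ₁ ∈ K, ∀ κ₂ ∈ K, EqOn (u.core κ₁) (u.core κ₂) (Icc 0 ℓ)

end SingleKnotGraph

/-- The action of a function on an interval. -/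
def intervalAction (p : ℝ) (I : Set ℝ) (u : ℝ → ℝ) : ℝ :=
  (1 / 2) * (∫ x in I, (weakDeriv I u x ^ 2 + u x ^ 2)) - (1 / p) * ∫ x in I, |u x| ^ p

/-- The action functional `S` on the graph. -/
def SingleKnotGraph.Func.action {H P L : ℕ} {G : SingleKnotGraph H P L} (p : ℝ) (u : G.Func) : ℝ :=
  ∑ e, intervalAction p (G.dom e) (u.edge e)

/-- The soliton `φ(x) = (p/2)^(1/(p-2)) sech^(2/(p-2)) ((p-2)x/2)` of the real line. -/
def soliton (p : ℝ) (x : ℝ) : ℝ :=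
  (p / 2) ^ (1 / (p - 2)) * (Real.cosh ((p - 2) / 2 * x))⁻¹ ^ (2 / (p - 2))

end

/-! The bound-state is assembled from three solutions of $u''=u-u^{p-1}$ with the common value
$\delta$ at the vertex. Half-lines carry the shifted soliton $\varphi(a+x)$ with
$\varphi(a)=\delta$. Compact edges outside $\mathcal G_0$ carry a small convex solution `y`,
horizontal at the far end. Edges in $\mathcal G_0$ carry a bump `Z` that rises from $\delta$ and is
horizontal at $x=\ell$. Zero slope at $x=\ell$ is the natural condition at the tip of a pendant, and
it makes the solution even about $\ell$, so that the same profile fits a loop of length $2\ell$.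
What remains is the flux condition at the vertex, and it prescribes the initial slope of `Z`
(`fluxSlope`) in terms of `y`.

One parameter is left, the height $m$ of `y` at the far end, and `exists_shooting` chooses it so
that `Z` first turns exactly at $\ell$. For tiny $m$ the solution `Z` is still rising at time
$\ell$. When $\delta$ reaches the threshold $\delta_1$, `exists_turning_time` makes `Z` turn within
a time independent of $\ell$. The intermediate value theorem is applied to the smaller of
$\delta_1-\delta$ and the minimum of `Z'`; the energy forbids an interior zero of a nonnegative
`Z'`. The force is truncated, so that it is bounded and Lipschitz and all solutions are global; the
energy barrier `IsNewtonSol.le_topLevel` shows that the truncation is inactive on the bump.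

For closeness to $\varphi$ (`exists_close_to_soliton`), small data at the vertex mean an energy near
zero, hence a peak near $\varphi(0)$. Grönwall from the peak covers a fixed length $R$, and
monotonicity covers the rest. For the action, testing the equation with $v$ itself leaves
$(\frac12-\frac1p)\int|v|^p$. The small parts of this integral are controlled by slopes, since
$u''\ge c\,u$ while $0<u\le\frac12$ (`IsNewtonSol.integral_rpow_le`). -/

noncomputable section

/-! ### Weak derivatives and integration by parts in $H^1$ of an interval -/

/-- Integration by parts against a compactly supported test function. -/
theorem isWeakDeriv_of_hasDerivAt {I : Set ℝ} {u u' : ℝ → ℝ}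
    (hu : ∀ x, HasDerivAt u (u' x) x) (hu' : Continuous u') : IsWeakDeriv I u u' := by
  intro ψ hψ hc hs
  have hcu : Continuous u := continuous_iff_continuousAt.2 fun x => (hu x).continuousAt
  have hcψ : Continuous (deriv ψ) := hψ.continuous_deriv (by simp)
  have h0 : ∀ x, x ∉ I → ψ x = 0 := fun x hx =>
    image_eq_zero_of_notMem_tsupport fun h => hx (interior_subset (hs h))
  have h1 : ∀ x, x ∉ I → deriv ψ x = 0 := fun x hx =>
    image_eq_zero_of_notMem_tsupport fun h =>
      hx (interior_subset (hs (tsupport_deriv_subset h)))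
  rw [setIntegral_eq_integral_of_forall_compl_eq_zero fun x hx => by rw [h1 x hx, mul_zero],
    setIntegral_eq_integral_of_forall_compl_eq_zero fun x hx => by rw [h0 x hx, mul_zero]]
  exact integral_mul_deriv_eq_deriv_mul_of_integrable (u := u) (v := ψ) (fun x _ => hu x)
    (fun x _ => (hψ.differentiable (by simp) x).hasDerivAt)
    ((hcu.mul hcψ).integrable_of_hasCompactSupport hc.deriv.mul_left)
    ((hu'.mul hψ.continuous).integrable_of_hasCompactSupport hc.mul_left)
    ((hcu.mul hψ.continuous).integrable_of_hasCompactSupport hc.mul_left)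

theorem locallyIntegrableOn_interior_of_memLp_two {I : Set ℝ} {g : ℝ → ℝ}
    (hg : MemLp g 2 (volume.restrict I)) : LocallyIntegrableOn g (interior I) := by
  refine (locallyIntegrableOn_iff isOpen_interior.isLocallyClosed).2 fun k hk hkc => ?_
  have h : MemLp g 2 (volume.restrict k) :=
    hg.mono_measure (Measure.restrict_mono (hk.trans interior_subset) le_rfl)
  have : IsFiniteMeasure (volume.restrict k) := ⟨by simpa using hkc.measure_lt_top⟩
  exact h.integrable (by norm_num)

/-- Test functions see only the interior of `I`, which is why its complement in `I` has to be null.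
-/
theorem IsWeakDeriv.ae_eq {I : Set ℝ} (hI : volume (I \ interior I) = 0)
    {u g₁ g₂ : ℝ → ℝ} (h₁ : MemLp g₁ 2 (volume.restrict I)) (h₂ : MemLp g₂ 2 (volume.restrict I))
    (w₁ : IsWeakDeriv I u g₁) (w₂ : IsWeakDeriv I u g₂) : g₁ =ᵐ[volume.restrict I] g₂ := by
  have hl₁ := locallyIntegrableOn_interior_of_memLp_two h₁
  have hl₂ := locallyIntegrableOn_interior_of_memLp_two h₂
  have key := isOpen_interior.ae_eq_zero_of_integral_contDiff_smul_eq_zero (hl₁.sub hl₂)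
    (fun ψ hψ hc hs => by
      have e := w₁ ψ hψ hc hs
      rw [w₂ ψ hψ hc hs, neg_inj] at e
      have h0 : ∀ x, x ∉ I → ψ x = 0 := fun x hx =>
        image_eq_zero_of_notMem_tsupport fun h => hx (interior_subset (hs h))
      have hψ2 : MemLp ψ 2 (volume.restrict I) :=
        hψ.continuous.memLp_of_hasCompactSupport hc
      have hi₁ : Integrable (fun x => g₁ x * ψ x) (volume.restrict I) := h₁.integrable_mul hψ2
      have hi₂ : Integrable (fun x => g₂ x * ψ x) (volume.restrict I) := h₂.integrable_mul hψ2
      rw [← setIntegral_eq_integral_of_forall_compl_eq_zero (s := I)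
        fun x hx => by rw [h0 x hx, zero_smul]]
      have : ∀ x, ψ x • (g₁ - g₂) x = g₁ x * ψ x - g₂ x * ψ x := fun x => by
        simp only [Pi.sub_apply, smul_eq_mul]; ring
      simp_rw [this]
      rw [integral_sub hi₁ hi₂, e, sub_self])
  have hd : ∀ᵐ x ∂volume.restrict I, x ∈ interior I := by
    rw [ae_iff]
    have : {x | x ∉ interior I} = (interior I)ᶜ := rfl
    rw [this, Measure.restrict_apply isOpen_interior.measurableSet.compl, inter_comm]
    exact hI
  filter_upwards [ae_restrict_of_ae key, hd] with x hx hx'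
  exact sub_eq_zero.1 (hx hx')

theorem weakDeriv_spec {I : Set ℝ} {u : ℝ → ℝ} (h : MemH1Interval I u) :
    MemLp (weakDeriv I u) 2 (volume.restrict I) ∧ IsWeakDeriv I u (weakDeriv I u) := by
  rw [weakDeriv, dif_pos h.2]
  exact h.2.choose_spec

/-- Allows the derivative picked by choice in `weakDeriv` to be replaced by the classical one under
integrals. -/
theorem weakDeriv_ae_eq {I : Set ℝ} (hI : volume (I \ interior I) = 0) {u u' : ℝ → ℝ}
    (hu : ∀ x, HasDerivAt u (u' x) x) (hc : Continuous u')
    (hu' : MemLp u' 2 (volume.restrict I)) : weakDeriv I u =ᵐ[volume.restrict I] u' := by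
  have hw := isWeakDeriv_of_hasDerivAt (I := I) hu hc
  have h : ∃ g : ℝ → ℝ, MemLp g 2 (volume.restrict I) ∧ IsWeakDeriv I u g := ⟨u', hu', hw⟩
  have hs : MemLp (weakDeriv I u) 2 (volume.restrict I) ∧ IsWeakDeriv I u (weakDeriv I u) := by
    rw [weakDeriv, dif_pos h]
    exact h.choose_spec
  exact IsWeakDeriv.ae_eq hI hs.1 hu' hs.2 hw

/-- The primitive from `a` vanishes to the left of the support of `θ`, and to its right because `θ`
has mean zero. -/
theorem exists_contDiff_primitive {a b : ℝ} (hab : a < b) {θ : ℝ → ℝ} (hθ : ContDiff ℝ ∞ θ)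
    (hc : HasCompactSupport θ) (hs : tsupport θ ⊆ Ioo a b) (h0 : ∫ x, θ x = 0) :
    ∃ ψ : ℝ → ℝ, ContDiff ℝ ∞ ψ ∧ HasCompactSupport ψ ∧ tsupport ψ ⊆ Ioo a b ∧ deriv ψ = θ := by
  have hd : ∀ x, HasDerivAt (fun x => ∫ t in a..x, θ t) (θ x) x := fun x =>
    intervalIntegral.integral_hasDerivAt_right (hθ.continuous.intervalIntegrable _ _)
      (hθ.continuous.stronglyMeasurableAtFilter _ _) hθ.continuous.continuousAt
  have hde : deriv (fun x => ∫ t in a..x, θ t) = θ := funext fun x => (hd x).deriv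
  -- The midpoint is added only to make the set nonempty, so that its infimum and supremum belong to
  -- it.
  have hS : IsCompact (tsupport θ ∪ {(a + b) / 2}) := hc.isCompact.union isCompact_singleton
  have hne : (tsupport θ ∪ {(a + b) / 2}).Nonempty := ⟨(a + b) / 2, by simp⟩
  have hSs : tsupport θ ∪ {(a + b) / 2} ⊆ Ioo a b :=
    union_subset hs (by rintro x rfl; constructor <;> linarith)
  have ha := hSs (hS.sInf_mem hne)
  have hb := hSs (hS.sSup_mem hne)
  set a' := sInf (tsupport θ ∪ {(a + b) / 2})
  set b' := sSup (tsupport θ ∪ {(a + b) / 2})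
  have hz : ∀ x, x ∉ Icc a' b' → θ x = 0 := fun x hx =>
    image_eq_zero_of_notMem_tsupport fun h =>
      hx ⟨csInf_le hS.bddBelow (Or.inl h), le_csSup hS.bddAbove (Or.inl h)⟩
  have hsub : Function.support (fun x => ∫ t in a..x, θ t) ⊆ Icc a' b' := by
    intro x hx
    by_contra hn
    refine hx ?_
    rcases not_and_or.1 hn with h | h
    · push Not at h
      refine intervalIntegral.integral_zero_ae (Filter.Eventually.of_forall fun t ht => hz t ?_)
      intro h'
      rcases mem_uIoc.1 ht with h2 | h2 <;> linarith [h2.1, h2.2, h'.1, ha.1]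
    · push Not at h
      have : ∫ t in a..x, θ t = ∫ t, θ t := by
        refine intervalIntegral.integral_eq_integral_of_support_subset fun t ht => ?_
        by_contra h2
        refine ht (hz t fun h3 => h2 ⟨by linarith [ha.1, h3.1], by linarith [h3.2]⟩)
      simp only [this, h0]
  have hts : tsupport (fun x => ∫ t in a..x, θ t) ⊆ Icc a' b' :=
    closure_minimal hsub isClosed_Icc
  refine ⟨fun x => ∫ t in a..x, θ t, contDiff_infty_iff_deriv.2 ⟨fun x => (hd x).differentiableAt,
    by rwa [hde]⟩, HasCompactSupport.of_support_subset_isCompact isCompact_Icc hsub, ?_, hde⟩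
  exact hts.trans fun x hx => ⟨by linarith [hx.1, ha.1], by linarith [hx.2, hb.2]⟩

/-- The lemma of du Bois-Reymond. -/
theorem exists_eq_const_of_integral_mul_deriv_eq_zero {a b : ℝ} (hab : a < b) {h : ℝ → ℝ}
    (hh : ContinuousOn h (Icc a b))
    (h0 : ∀ ψ : ℝ → ℝ, ContDiff ℝ ∞ ψ → HasCompactSupport ψ → tsupport ψ ⊆ Ioo a b →
      ∫ x in Ioo a b, h x * deriv ψ x = 0) : ∃ c, ∀ x ∈ Icc a b, h x = c := by
  let ρ : ContDiffBump ((a + b) / 2) :=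
    ⟨(b - a) / 8, (b - a) / 4, by linarith, by linarith⟩
  have hρs : tsupport (ρ.normed volume) ⊆ Ioo a b := by
    rw [ρ.tsupport_normed_eq, Real.closedBall_eq_Icc]
    intro x hx
    have e : ρ.rOut = (b - a) / 4 := rfl
    rw [e] at hx
    constructor <;> linarith [hx.1, hx.2]
  have hρi : ∫ x, ρ.normed volume x = 1 := ρ.integral_normed
  have hint : ∀ f : ℝ → ℝ, Continuous f → IntegrableOn (fun x => h x * f x) (Ioo a b) := by
    intro f hf
    exact ((hh.mul hf.continuousOn).integrableOn_compact isCompact_Icc).mono_set Ioo_subset_Icc_self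
  set c := ∫ x in Ioo a b, h x * ρ.normed volume x with hc
  have hli : LocallyIntegrableOn (fun x => h x - c) (Ioo a b) :=
    ((hh.sub continuousOn_const).mono Ioo_subset_Icc_self).locallyIntegrableOn measurableSet_Ioo
  have key := isOpen_Ioo.ae_eq_zero_of_integral_contDiff_smul_eq_zero hli
    (fun f hf hfc hfs => by
      have hz : ∀ x, x ∉ Ioo a b → f x = 0 := fun x hx =>
        image_eq_zero_of_notMem_tsupport fun h => hx (hfs h)
      rw [← setIntegral_eq_integral_of_forall_compl_eq_zero (s := Ioo a b)
        fun x hx => by rw [hz x hx, zero_smul]]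
      have hfi : Integrable f := hf.continuous.integrable_of_hasCompactSupport hfc
      have hρint : Integrable (ρ.normed volume) :=
        ρ.contDiff_normed (n := 0) |>.continuous.integrable_of_hasCompactSupport
          ρ.hasCompactSupport_normed
      -- Subtracting `(∫ f) ρ`, where `ρ` has integral one, makes any test function `f` a derivative
      -- of a test function. Hence `h` pairs with `f` as the constant `∫ h ρ` does.
      obtain ⟨ψ, hψ, hψc, hψs, hψd⟩ := exists_contDiff_primitive hab
        (θ := fun x => f x - (∫ y, f y) * ρ.normed volume x)
        (hf.sub (contDiff_const.mul ρ.contDiff_normed))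
        (hfc.sub ρ.hasCompactSupport_normed.mul_left)
        ((tsupport_sub _ _).trans (union_subset hfs ((tsupport_mul_subset_right).trans hρs)))
        (by rw [integral_sub hfi (hρint.const_mul _), integral_const_mul, hρi, mul_one, sub_self])
      have e := h0 ψ hψ hψc hψs
      rw [hψd] at e
      have e2 : ∫ x in Ioo a b, f x = ∫ x, f x := setIntegral_eq_integral_of_forall_compl_eq_zero hz
      have e3 : ∀ x, h x * (f x - (∫ y, f y) * ρ.normed volume x)
          = h x * f x - (∫ y, f y) * (h x * ρ.normed volume x) := fun x => by ring
      have e4 : ∀ x, f x • (h x - c) = h x * f x - c * f x := fun x => by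
        rw [smul_eq_mul]; ring
      simp_rw [e3] at e
      simp_rw [e4]
      rw [integral_sub (hint f hf.continuous)
        ((hint _ (ρ.contDiff_normed (n := 0)).continuous).const_mul _), integral_const_mul, ← hc] at e
      rw [integral_sub (hint f hf.continuous) (hfi.integrableOn.const_mul _), integral_const_mul, e2]
      linarith)
  refine ⟨c, ?_⟩
  have h1 : EqOn h (fun _ => c) (Ioo a b) := by
    refine Measure.eqOn_open_of_ae_eq (μ := volume) ?_ isOpen_Ioo (hh.mono Ioo_subset_Icc_self)
      continuousOn_const
    rw [Filter.EventuallyEq, ae_restrict_iff' measurableSet_Ioo]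
    filter_upwards [key] with x hx hx'
    exact sub_eq_zero.1 (hx hx')
  have h2 := h1.of_subset_closure hh continuousOn_const Ioo_subset_Icc_self
    (by rw [closure_Ioo hab.ne])
  exact fun x hx => h2 hx

/-- The difference of `u` and the primitive of `g` is orthogonal to all derivatives of test
functions, hence constant by du Bois-Reymond. This makes `u` absolutely continuous and gives access
to the product rule. -/
theorem sub_eq_integral_weakDeriv {a b : ℝ} (hab : a < b) {u g : ℝ → ℝ}
    (hu : ContinuousOn u (Icc a b)) (hg : IntervalIntegrable g volume a b)
    (hw : ∀ ψ : ℝ → ℝ, ContDiff ℝ ∞ ψ → HasCompactSupport ψ → tsupport ψ ⊆ Ioo a b →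
      ∫ x in Ioo a b, u x * deriv ψ x = -∫ x in Ioo a b, g x * ψ x) :
    ∀ x ∈ Icc a b, u x = u a + ∫ t in a..x, g t := by
  have hac := hg.absolutelyContinuousOnInterval_intervalIntegral (c := a) left_mem_uIcc
  have hGc : ContinuousOn (fun x => ∫ t in a..x, g t) (Icc a b) := by
    have := hac.continuousOn
    rwa [uIcc_of_le hab.le] at this
  obtain ⟨c, hc⟩ := exists_eq_const_of_integral_mul_deriv_eq_zero hab (hu.sub hGc) (by
    intro ψ hψ hψc hψs
    have hψa : ∀ x, x ∉ Ioo a b → ψ x = 0 := fun x hx =>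
        image_eq_zero_of_notMem_tsupport fun h => hx (hψs h)
    have hcd : Continuous (deriv ψ) := hψ.continuous_deriv (by simp)
    have hi : ∀ f : ℝ → ℝ, ContinuousOn f (Icc a b) →
        IntegrableOn (fun x => f x * deriv ψ x) (Ioo a b) := fun f hf =>
      ((hf.mul hcd.continuousOn).integrableOn_compact isCompact_Icc).mono_set Ioo_subset_Icc_self
    have e : ∀ x, (u x - ∫ t in a..x, g t) * deriv ψ x
        = u x * deriv ψ x - (∫ t in a..x, g t) * deriv ψ x := fun x => by ring
    simp only [Pi.sub_apply, e]
    rw [integral_sub (hi _ hu) (hi _ hGc), hw ψ hψ hψc hψs]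
    have hψac : AbsolutelyContinuousOnInterval ψ a b :=
      ContDiffOn.absolutelyContinuousOnInterval (hψ.of_le (by simp)).contDiffOn
    have p := hac.integral_mul_deriv_eq_deriv_mul hψac
    rw [hψa a (by simp), hψa b (by simp), mul_zero, mul_zero, sub_zero, zero_sub] at p
    rw [← integral_Ioc_eq_integral_Ioo, ← integral_Ioc_eq_integral_Ioo,
      ← intervalIntegral.integral_of_le hab.le, ← intervalIntegral.integral_of_le hab.le, p]
    rw [sub_neg_eq_add, neg_add_eq_zero]
    refine intervalIntegral.integral_congr_ae ?_
    filter_upwards [hg.ae_hasDerivAt_integral] with x hx hx'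
    rw [(hx (uIoc_subset_uIcc hx') a left_mem_uIcc).deriv])
  intro x hx
  have h1 := hc x hx
  have h2 := hc a (left_mem_Icc.2 hab.le)
  simp only [Pi.sub_apply, intervalIntegral.integral_same] at h1 h2
  linarith

theorem MemH1Interval.intervalIntegrable_weakDeriv {I : Set ℝ} {u : ℝ → ℝ} (h : MemH1Interval I u)
    {a b : ℝ} (hab : a ≤ b) (hI : Icc a b ⊆ I) : IntervalIntegrable (weakDeriv I u) volume a b := by
  rw [intervalIntegrable_iff_integrableOn_Icc_of_le hab]
  exact ((weakDeriv_spec h).1.mono_measure (Measure.restrict_mono hI le_rfl)).integrable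
    (by norm_num)

/-- Integration by parts between a `C¹` function and a function in `H¹`. -/
theorem MemH1Interval.integral_mul_weakDeriv_add {I : Set ℝ} {u : ℝ → ℝ} (h : MemH1Interval I u)
    (hu : ContinuousOn u I) {a b : ℝ} (hab : a < b) (hI : Icc a b ⊆ I) {f f' : ℝ → ℝ}
    (hf : ∀ x, HasDerivAt f (f' x) x) (hf' : Continuous f') :
    ∫ x in a..b, (f x * weakDeriv I u x + f' x * u x) = f b * u b - f a * u a := by
  have hg := h.intervalIntegrable_weakDeriv hab.le hI
  have hIoo : Ioo a b ⊆ interior I := isOpen_Ioo.subset_interior_iff.2 (Ioo_subset_Icc_self.trans hI)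
  have key := sub_eq_integral_weakDeriv hab (hu.mono hI) hg (by
    intro ψ hψ hψc hψs
    have hz : ∀ x, x ∉ Ioo a b → ψ x = 0 := fun x hx =>
        image_eq_zero_of_notMem_tsupport fun h => hx (hψs h)
    have hz' : ∀ x, x ∉ Ioo a b → deriv ψ x = 0 := fun x hx =>
        image_eq_zero_of_notMem_tsupport fun h => hx (hψs (tsupport_deriv_subset h))
    have e := (weakDeriv_spec h).2 ψ hψ hψc (hψs.trans hIoo)
    rw [setIntegral_eq_integral_of_forall_compl_eq_zero fun x hx => by rw [hz' x hx, mul_zero],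
      setIntegral_eq_integral_of_forall_compl_eq_zero fun x hx => by rw [hz x hx, mul_zero]]
    rwa [setIntegral_eq_integral_of_forall_compl_eq_zero fun x hx => by
        rw [hz' x fun h => hx (interior_subset (hIoo h)), mul_zero],
      setIntegral_eq_integral_of_forall_compl_eq_zero fun x hx => by
        rw [hz x fun h => hx (interior_subset (hIoo h)), mul_zero]] at e)
  have hfd : Differentiable ℝ f := fun x => (hf x).differentiableAt
  have hfe : deriv f = f' := funext fun x => (hf x).deriv
  have hfac : AbsolutelyContinuousOnInterval f a b :=
    ContDiffOn.absolutelyContinuousOnInterval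
      (contDiff_one_iff_deriv.2 ⟨hfd, by rwa [hfe]⟩).contDiffOn
  have hgac := hg.absolutelyContinuousOnInterval_intervalIntegral (c := a) left_mem_uIcc
  have p := hfac.integral_deriv_mul_eq_sub hgac
  have hi1 : IntervalIntegrable f' volume a b := hf'.intervalIntegrable _ _
  have ftc : ∫ x in a..b, f' x = f b - f a :=
    intervalIntegral.integral_eq_sub_of_hasDerivAt (fun x _ => hf x) hi1
  have hGc : ContinuousOn (fun x => ∫ t in a..x, weakDeriv I u t) (uIcc a b) := hgac.continuousOn
  have e : ∫ x in a..b, (f x * weakDeriv I u x + f' x * u x)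
      = ∫ x in a..b, ((deriv f x * (∫ t in a..x, weakDeriv I u t)
        + f x * deriv (fun x => ∫ t in a..x, weakDeriv I u t) x) + u a * f' x) := by
    refine intervalIntegral.integral_congr_ae ?_
    filter_upwards [hg.ae_hasDerivAt_integral] with x hx hx'
    rw [(hx (uIoc_subset_uIcc hx') a left_mem_uIcc).deriv, hfe]
    have := key x (by rw [← uIcc_of_le hab.le]; exact uIoc_subset_uIcc hx')
    rw [this]; ring
  rw [e, intervalIntegral.integral_add, p, intervalIntegral.integral_const_mul, ftc,
    intervalIntegral.integral_same, key b (right_mem_Icc.2 hab.le)]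
  · ring
  · refine IntervalIntegrable.add ?_ ?_
    · rw [hfe]
      exact hi1.mul_continuousOn hGc
    · refine IntervalIntegrable.continuousOn_mul ?_ hfd.continuous.continuousOn
      exact hgac.intervalIntegrable_deriv
  · exact hi1.const_mul _

/-- Integration by parts on a half-line. -/
theorem MemH1Interval.integral_Ici_mul_weakDeriv_add {u : ℝ → ℝ} (h : MemH1Interval (Ici 0) u)
    (hu : ContinuousOn u (Ici 0)) {f f' : ℝ → ℝ}
    (hf : ∀ x, HasDerivAt f (f' x) x) (hc : Continuous f')
    (hf2 : MemLp f 2 (volume.restrict (Ici 0))) (hf' : MemLp f' 2 (volume.restrict (Ici 0))) :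
    ∫ x in Ici 0, (f x * weakDeriv (Ici 0) u x + f' x * u x) = - (f 0 * u 0) := by
  have hi : IntegrableOn (fun x => f x * weakDeriv (Ici 0) u x + f' x * u x) (Ici 0) :=
    (hf2.integrable_mul (weakDeriv_spec h).1).add (hf'.integrable_mul h.1)
  have hfu : IntegrableOn (fun x => f x * u x) (Ici 0) := hf2.integrable_mul h.1
  have ht := intervalIntegral_tendsto_integral_Ioi 0 (hi.mono_set Ioi_subset_Ici_self)
    Filter.tendsto_id
  have ht2 : Filter.Tendsto (fun x => f x * u x) Filter.atTop
      (nhds ((∫ x in Ioi 0, (f x * weakDeriv (Ici 0) u x + f' x * u x)) + f 0 * u 0)) := by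
    refine (ht.add_const (f 0 * u 0)).congr' ?_
    filter_upwards [Filter.eventually_gt_atTop 0] with x hx
    rw [id, h.integral_mul_weakDeriv_add hu hx Icc_subset_Ici_self hf hc]
    ring
  -- The product `f u` is integrable and has a limit at infinity, so the limit is zero.
  have h0 := IntegrableAtFilter.eq_zero_of_tendsto (μ := volume)
    ⟨Ici 0, Filter.Ici_mem_atTop 0, hfu⟩ (fun s hs => by
      obtain ⟨a, ha⟩ := Filter.mem_atTop_sets.1 hs
      exact top_unique (by rw [← Real.volume_Ici (a := a)]; exact measure_mono ha)) ht2
  rw [integral_Ici_eq_integral_Ioi]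
  linarith

/-! ### The soliton: its equation, monotonicity and decay -/

/-- The derivative of the soliton. -/
def solitonDeriv (p x : ℝ) : ℝ := -(soliton p x * Real.tanh ((p - 2) / 2 * x))

theorem soliton_pos {p : ℝ} (hp : 2 < p) (x : ℝ) : 0 < soliton p x := by
  have := Real.cosh_pos ((p - 2) / 2 * x)
  unfold soliton; positivity

theorem soliton_neg (p x : ℝ) : soliton p (-x) = soliton p x := by
  simp [soliton]

theorem soliton_zero (p : ℝ) : soliton p 0 = (p / 2) ^ (1 / (p - 2)) := by
  simp [soliton]

theorem solitonDeriv_zero (p : ℝ) : solitonDeriv p 0 = 0 := by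
  simp [solitonDeriv]

theorem hasDerivAt_tanh (x : ℝ) : HasDerivAt Real.tanh (1 - Real.tanh x ^ 2) x := by
  have h := (Real.hasDerivAt_sinh x).div (Real.hasDerivAt_cosh x) (Real.cosh_pos x).ne'
  have e : Real.tanh = fun x => Real.sinh x / Real.cosh x := funext Real.tanh_eq_sinh_div_cosh
  rw [e]
  refine h.congr_deriv ?_
  have := (Real.cosh_pos x).ne'
  field_simp

/-- Since $\operatorname{sech}^2=1-\tanh^2$, the power nonlinearity becomes a polynomial in $\tanh$;
the soliton equation and the first integral are then algebra. -/
theorem soliton_rpow {p : ℝ} (hp : 2 < p) (x : ℝ) :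
    soliton p x ^ (p - 2) = p / 2 * (1 - Real.tanh ((p - 2) / 2 * x) ^ 2) := by
  have hc := Real.cosh_pos ((p - 2) / 2 * x)
  have h2 : p - 2 ≠ 0 := by linarith
  rw [soliton, Real.mul_rpow (by positivity) (by positivity), ← Real.rpow_mul (by linarith),
    ← Real.rpow_mul (by positivity), one_div_mul_cancel h2, div_mul_cancel₀ _ h2, Real.rpow_one,
    Real.rpow_two, Real.tanh_eq_sinh_div_cosh]
  congr 1
  rw [div_pow, Real.sinh_sq]
  field_simp
  ring

theorem hasDerivAt_soliton {p : ℝ} (hp : 2 < p) (x : ℝ) :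
    HasDerivAt (soliton p) (solitonDeriv p x) x := by
  have hc := Real.cosh_pos ((p - 2) / 2 * x)
  have h2 : p - 2 ≠ 0 := by linarith
  have h1 : HasDerivAt (fun x => (p - 2) / 2 * x) ((p - 2) / 2) x := by
    simpa using (hasDerivAt_id x).const_mul ((p - 2) / 2)
  have h := (((h1.cosh.inv hc.ne').rpow_const (p := 2 / (p - 2))
    (Or.inl (inv_pos.2 hc).ne')).const_mul ((p / 2) ^ (1 / (p - 2))))
  refine h.congr_deriv ?_
  have e : (Real.cosh ((p - 2) / 2 * x))⁻¹ ^ (2 / (p - 2) - 1)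
      = (Real.cosh ((p - 2) / 2 * x))⁻¹ ^ (2 / (p - 2)) * Real.cosh ((p - 2) / 2 * x) := by
    rw [Real.rpow_sub_one (inv_pos.2 hc).ne', div_inv_eq_mul]
  simp only [Pi.inv_apply]
  rw [e, solitonDeriv, soliton, Real.tanh_eq_sinh_div_cosh]
  field_simp

theorem rpow_sub_one_eq_mul {p z : ℝ} (hz : 0 < z) : z ^ (p - 1) = z * z ^ (p - 2) := by
  rw [show p - 1 = 1 + (p - 2) by ring, Real.rpow_add hz, Real.rpow_one]

theorem rpow_eq_sq_mul {p z : ℝ} (hz : 0 < z) : z ^ p = z ^ 2 * z ^ (p - 2) := by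
  rw [← Real.rpow_two, ← Real.rpow_add hz]; congr 1; ring

theorem hasDerivAt_solitonDeriv {p : ℝ} (hp : 2 < p) (x : ℝ) :
    HasDerivAt (solitonDeriv p) (soliton p x - soliton p x ^ (p - 1)) x := by
  have h1 : HasDerivAt (fun x => (p - 2) / 2 * x) ((p - 2) / 2) x := by
    simpa using (hasDerivAt_id x).const_mul ((p - 2) / 2)
  have h := ((hasDerivAt_soliton hp x).mul ((hasDerivAt_tanh _).comp x h1)).neg
  refine h.congr_deriv ?_
  rw [rpow_sub_one_eq_mul (soliton_pos hp x), soliton_rpow hp, solitonDeriv]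
  simp only [Function.comp_apply]
  ring

theorem continuous_soliton {p : ℝ} (hp : 2 < p) : Continuous (soliton p) :=
  continuous_iff_continuousAt.2 fun x => (hasDerivAt_soliton hp x).continuousAt

theorem continuous_solitonDeriv {p : ℝ} (hp : 2 < p) : Continuous (solitonDeriv p) :=
  continuous_iff_continuousAt.2 fun x => (hasDerivAt_solitonDeriv hp x).continuousAt

theorem tanh_sq_lt_one (x : ℝ) : Real.tanh x ^ 2 < 1 := by
  have hc := Real.cosh_pos x
  rw [Real.tanh_eq_sinh_div_cosh, div_pow, div_lt_one (by positivity), Real.sinh_sq]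
  linarith

theorem tanh_pos_of_pos {x : ℝ} (hx : 0 < x) : 0 < Real.tanh x := by
  rw [Real.tanh_eq_sinh_div_cosh]
  exact div_pos (Real.sinh_pos_iff.2 hx) (Real.cosh_pos x)

theorem abs_solitonDeriv_le {p : ℝ} (hp : 2 < p) (x : ℝ) :
    |solitonDeriv p x| ≤ soliton p x := by
  have h := abs_le_of_sq_le_sq (show Real.tanh ((p - 2) / 2 * x) ^ 2 ≤ 1 ^ 2 by
    simpa using (tanh_sq_lt_one _).le) zero_le_one
  rw [solitonDeriv, abs_neg, abs_mul, abs_of_pos (soliton_pos hp x)]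
  exact mul_le_of_le_one_right (soliton_pos hp x).le h

theorem solitonDeriv_neg_of_pos {p x : ℝ} (hp : 2 < p) (hx : 0 < x) : solitonDeriv p x < 0 := by
  have := tanh_pos_of_pos (mul_pos (show 0 < (p - 2) / 2 by linarith) hx)
  have := mul_pos (soliton_pos hp x) this
  rw [solitonDeriv]; linarith

/-- The soliton lies on the zero energy level, so its slope is a function of its value. This is the
contribution of a half-line to `fluxSlope`. -/
theorem solitonDeriv_eq_sqrt {p x : ℝ} (hp : 2 < p) (hx : 0 ≤ x) :
    solitonDeriv p x = -(soliton p x * √(1 - 2 / p * soliton p x ^ (p - 2))) := by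
  have hp0 : p ≠ 0 := by linarith
  have h0 : 0 ≤ Real.tanh ((p - 2) / 2 * x) := by
    rcases hx.eq_or_lt with rfl | hx
    · simp
    · exact (tanh_pos_of_pos (mul_pos (by linarith) hx)).le
  rw [soliton_rpow hp, solitonDeriv]
  congr 2
  rw [show 1 - 2 / p * (p / 2 * (1 - Real.tanh ((p - 2) / 2 * x) ^ 2))
    = Real.tanh ((p - 2) / 2 * x) ^ 2 by field_simp; ring, Real.sqrt_sq h0]

theorem strictAntiOn_soliton {p : ℝ} (hp : 2 < p) : StrictAntiOn (soliton p) (Ici 0) := by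
  refine strictAntiOn_of_deriv_neg (convex_Ici 0) (continuous_soliton hp).continuousOn ?_
  intro x hx
  rw [interior_Ici] at hx
  rw [(hasDerivAt_soliton hp x).deriv]
  exact solitonDeriv_neg_of_pos hp hx

theorem soliton_le_zero {p : ℝ} (hp : 2 < p) (x : ℝ) : soliton p x ≤ soliton p 0 := by
  have key : ∀ x, 0 ≤ x → soliton p x ≤ soliton p 0 := fun x hx =>
    (strictAntiOn_soliton hp).antitoneOn self_mem_Ici hx hx
  rcases le_total 0 x with h | h
  · exact key x h
  · rw [← soliton_neg]; exact key _ (by linarith)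

/-- From $2\cosh s\ge e^{|s|}$; the two factors $\frac{p-2}2$ and $\frac2{p-2}$ cancel, which gives
decay rate one. -/
theorem exists_soliton_le_exp {p : ℝ} (hp : 2 < p) :
    ∃ C : ℝ, 0 < C ∧ ∀ x, soliton p x ≤ C * Real.exp (-|x|) := by
  refine ⟨(p / 2) ^ (1 / (p - 2)) * 2 ^ (2 / (p - 2)), by positivity, fun x => ?_⟩
  have h2 : 0 < p - 2 := by linarith
  have hc := Real.cosh_pos ((p - 2) / 2 * x)
  rw [soliton, mul_assoc]
  refine mul_le_mul_of_nonneg_left ?_ (by positivity)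
  have h1 : Real.exp ((p - 2) / 2 * |x|) ≤ 2 * Real.cosh ((p - 2) / 2 * x) := by
    rw [← Real.cosh_abs, abs_mul, abs_of_pos (show 0 < (p - 2) / 2 by linarith), Real.cosh_eq]
    linarith [Real.exp_pos (-((p - 2) / 2 * |x|))]
  have h3 : (Real.cosh ((p - 2) / 2 * x))⁻¹ ≤ 2 * Real.exp (-((p - 2) / 2 * |x|)) := by
    rw [Real.exp_neg, inv_le_iff_one_le_mul₀ hc, mul_assoc, mul_comm _ (Real.cosh _), ← mul_assoc,
      ← div_eq_mul_inv, one_le_div (Real.exp_pos _)]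
    exact h1
  refine (Real.rpow_le_rpow (by positivity) h3 (by positivity)).trans_eq ?_
  rw [Real.mul_rpow (by norm_num) (Real.exp_pos _).le, ← Real.exp_mul]
  congr 2
  field_simp

theorem integrable_exp_neg_abs : Integrable fun x : ℝ => Real.exp (-|x|) := by
  rw [← integrableOn_univ, ← Iic_union_Ioi (a := (0 : ℝ)), integrableOn_union]
  constructor
  · refine (integrableOn_exp_Iic 0).congr_fun (fun x hx => ?_) measurableSet_Iic
    rw [abs_of_nonpos hx, neg_neg]
  · refine (integrableOn_exp_neg_Ioi 0).congr_fun (fun x hx => ?_) measurableSet_Ioi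
    simp only [abs_of_pos (mem_Ioi.1 hx)]

theorem memLp_two_of_abs_le_exp {f : ℝ → ℝ} (hf : Continuous f) {C : ℝ}
    (h : ∀ x, |f x| ≤ C * Real.exp (-|x|)) : MemLp f 2 := by
  rw [memLp_two_iff_integrable_sq hf.aestronglyMeasurable]
  refine (integrable_exp_neg_abs.const_mul (C ^ 2)).mono' (hf.pow 2).aestronglyMeasurable
    (Filter.Eventually.of_forall fun x => ?_)
  rw [Real.norm_eq_abs, abs_pow]
  have h1 : Real.exp (-|x|) ^ 2 ≤ Real.exp (-|x|) := by
    have : Real.exp (-|x|) ≤ 1 := Real.exp_le_one_iff.2 (by simp)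
    nlinarith [Real.exp_pos (-|x|)]
  calc |f x| ^ 2 ≤ (C * Real.exp (-|x|)) ^ 2 := pow_le_pow_left₀ (abs_nonneg _) (h x) 2
    _ = C ^ 2 * Real.exp (-|x|) ^ 2 := by ring
    _ ≤ _ := mul_le_mul_of_nonneg_left h1 (by positivity)

theorem memLp_soliton_comp_add {p : ℝ} (hp : 2 < p) (a : ℝ) :
    MemLp (fun x => soliton p (a + x)) 2 ∧ MemLp (fun x => solitonDeriv p (a + x)) 2 := by
  obtain ⟨C, hC, h⟩ := exists_soliton_le_exp hp
  have key : ∀ x, soliton p (a + x) ≤ C * Real.exp |a| * Real.exp (-|x|) := fun x => by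
    refine (h _).trans ?_
    rw [mul_assoc, ← Real.exp_add]
    refine mul_le_mul_of_nonneg_left (Real.exp_le_exp.2 ?_) hC.le
    have := abs_sub_abs_le_abs_sub x (-a)
    rw [abs_neg, sub_neg_eq_add, add_comm x] at this
    linarith
  have hs : Continuous fun x => a + x := by fun_prop
  exact ⟨memLp_two_of_abs_le_exp ((continuous_soliton hp).comp hs) fun x => by
      rw [abs_of_pos (soliton_pos hp _)]; exact key x,
    memLp_two_of_abs_le_exp ((continuous_solitonDeriv hp).comp hs) fun x =>
      (abs_solitonDeriv_le hp _).trans (key x)⟩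

theorem integrable_soliton_rpow {p : ℝ} (hp : 2 < p) : Integrable fun x => soliton p x ^ p := by
  obtain ⟨C, hC, h⟩ := exists_soliton_le_exp hp
  have hc : Continuous fun x => soliton p x ^ p :=
    (continuous_soliton hp).rpow_const fun x => Or.inl (soliton_pos hp x).ne'
  refine (integrable_exp_neg_abs.const_mul (C ^ p)).mono' hc.aestronglyMeasurable
    (Filter.Eventually.of_forall fun x => ?_)
  have hs := soliton_pos hp x
  rw [Real.norm_eq_abs, abs_of_pos (by positivity)]
  refine (Real.rpow_le_rpow hs.le (h x) (by linarith)).trans ?_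
  rw [Real.mul_rpow hC.le (Real.exp_pos _).le, ← Real.exp_mul]
  refine mul_le_mul_of_nonneg_left (Real.exp_le_exp.2 ?_) (by positivity)
  nlinarith [abs_nonneg x]

theorem tendsto_soliton_atTop {p : ℝ} (hp : 2 < p) :
    Filter.Tendsto (soliton p) Filter.atTop (nhds 0) := by
  obtain ⟨C, hC, h⟩ := exists_soliton_le_exp hp
  refine squeeze_zero' (Filter.Eventually.of_forall fun x => (soliton_pos hp x).le)
    (Filter.eventually_ge_atTop 0 |>.mono fun x hx => (h x).trans_eq (by rw [abs_of_nonneg hx]))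
    (by simpa using (Real.tendsto_exp_neg_atTop_nhds_zero.const_mul C))

/-- Provides the shift on the half-lines; the range is sufficient because $\varphi(0)>1$. -/
theorem exists_soliton_eq {p δ : ℝ} (hp : 2 < p) (h0 : 0 < δ) (h1 : δ < 1) :
    ∃ a, 0 < a ∧ soliton p a = δ := by
  have hs0 : 1 < soliton p 0 := by
    rw [soliton_zero]
    exact Real.one_lt_rpow (by linarith) (by have : 0 < p - 2 := by linarith
                                             positivity)
  obtain ⟨R, hR, hR'⟩ := (((tendsto_soliton_atTop hp).eventually (gt_mem_nhds h0)).and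
    (Filter.eventually_ge_atTop 0)).exists
  obtain ⟨a, ha, ha'⟩ := intermediate_value_Icc' hR' (continuous_soliton hp).continuousOn
    (show δ ∈ Icc (soliton p R) (soliton p 0) from ⟨hR.le, by linarith⟩)
  refine ⟨a, ha.1.lt_of_ne ?_, ha'⟩
  rintro rfl
  linarith

/-! ### Newton equations with bounded Lipschitz force -/

/-- `y` is a global solution of `y'' = F y` with derivative `w`. -/
structure IsNewtonSol (F y w : ℝ → ℝ) : Prop where
  deriv_fst : ∀ t, HasDerivAt y (w t) t
  deriv_snd : ∀ t, HasDerivAt w (F (y t)) t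

/-- The first-order vector field of `y'' = F y`. -/
def newtonField (F : ℝ → ℝ) (z : ℝ × ℝ) : ℝ × ℝ := (z.2, F z.1)

theorem lipschitzWith_newtonField {F : ℝ → ℝ} {K : NNReal} (hF : LipschitzWith K F) :
    LipschitzWith (max 1 K) (newtonField F) := by
  have h := LipschitzWith.prodMk (LipschitzWith.prod_snd (α := ℝ) (β := ℝ))
    (hF.comp (LipschitzWith.prod_fst (α := ℝ) (β := ℝ)))
  rw [mul_one] at h
  exact h

namespace IsNewtonSol

variable {F y w y₁ w₁ y₂ w₂ : ℝ → ℝ}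

theorem hasDerivAt_prod (h : IsNewtonSol F y w) (t : ℝ) :
    HasDerivAt (fun t => (y t, w t)) (newtonField F (y t, w t)) t :=
  (h.deriv_fst t).prodMk (h.deriv_snd t)

theorem continuous_fst (h : IsNewtonSol F y w) : Continuous y :=
  continuous_iff_continuousAt.2 fun x => (h.deriv_fst x).continuousAt

theorem continuous_snd (h : IsNewtonSol F y w) : Continuous w :=
  continuous_iff_continuousAt.2 fun x => (h.deriv_snd x).continuousAt

/-- Grönwall's inequality. It serves three times: for continuous dependence, to keep solutions with
tiny data small up to time $\ell$, and to compare a bump with the soliton. -/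
theorem dist_le {K : NNReal} (hF : LipschitzWith K F) (h₁ : IsNewtonSol F y₁ w₁)
    (h₂ : IsNewtonSol F y₂ w₂) {t : ℝ} (ht : 0 ≤ t) :
    dist (y₁ t, w₁ t) (y₂ t, w₂ t)
      ≤ dist (y₁ 0, w₁ 0) (y₂ 0, w₂ 0) * Real.exp ((max 1 K : NNReal) * t) := by
  have := dist_le_of_trajectories_ODE (a := 0) (b := t) (v := fun _ => newtonField F)
    (fun _ => lipschitzWith_newtonField hF)
    (h₁.continuous_fst.prodMk h₁.continuous_snd).continuousOn
    (fun t _ => (h₁.hasDerivAt_prod t).hasDerivWithinAt)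
    (h₂.continuous_fst.prodMk h₂.continuous_snd).continuousOn
    (fun t _ => (h₂.hasDerivAt_prod t).hasDerivWithinAt) le_rfl t ⟨ht, le_rfl⟩
  simpa using this

theorem eq_of_eq_at {K : NNReal} (hF : LipschitzWith K F) (h₁ : IsNewtonSol F y₁ w₁)
    (h₂ : IsNewtonSol F y₂ w₂) {t₀ : ℝ} (hy : y₁ t₀ = y₂ t₀) (hw : w₁ t₀ = w₂ t₀) :
    y₁ = y₂ ∧ w₁ = w₂ := by
  have := ODE_solution_unique_univ (t₀ := t₀) (v := fun _ => newtonField F) (s := fun _ => univ)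
    (fun _ => (lipschitzWith_newtonField hF).lipschitzOnWith)
    (fun t => ⟨h₁.hasDerivAt_prod t, mem_univ _⟩) (fun t => ⟨h₂.hasDerivAt_prod t, mem_univ _⟩)
    (by rw [hy, hw])
  exact ⟨funext fun t => congrArg Prod.fst (congrFun this t),
    funext fun t => congrArg Prod.snd (congrFun this t)⟩

theorem comp_sub_left (h : IsNewtonSol F y w) (c : ℝ) :
    IsNewtonSol F (fun t => y (c - t)) (fun t => -w (c - t)) where
  deriv_fst t := (h.deriv_fst (c - t)).comp_const_sub c t
  deriv_snd t := ((h.deriv_snd (c - t)).comp_const_sub c t).neg.congr_deriv (neg_neg _)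

/-- A solution is symmetric about each of its critical points. -/
theorem symm_of_eq_zero {K : NNReal} (hF : LipschitzWith K F) (h : IsNewtonSol F y w) {c : ℝ}
    (hc : w c = 0) (t : ℝ) : y (2 * c - t) = y t ∧ w (2 * c - t) = -w t := by
  have := eq_of_eq_at hF (h.comp_sub_left (2 * c)) h (t₀ := c)
    (by ring_nf) (by rw [show 2 * c - c = c by ring, hc, neg_zero])
  exact ⟨congrFun this.1 t, by rw [← congrFun this.2 t, neg_neg]⟩

end IsNewtonSol

/-- The field is unbounded in the velocity, so the velocity is clamped at `V = |b| + B T` before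
Picard–Lindelöf is applied. As the force is at most `B`, the velocity moves by at most `B |t|` and
the clamp is never active. -/
theorem exists_newtonSol_Icc {F : ℝ → ℝ} {K : NNReal} (hF : LipschitzWith K F) {B : ℝ}
    (hB : ∀ y, |F y| ≤ B) (a b : ℝ) {T : ℝ} (hT : 0 < T) :
    ∃ z : ℝ → ℝ × ℝ, z 0 = (a, b) ∧
      ∀ t ∈ Ioo (-T) T, HasDerivAt z (newtonField F (z t)) t := by
  have hB0 : 0 ≤ B := (abs_nonneg _).trans (hB 0)
  set V : ℝ := |b| + B * T with hV
  have hV0 : 0 ≤ V := by positivity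
  set f : ℝ × ℝ → ℝ × ℝ := fun z => (max (-V) (min z.2 V), F z.1) with hf
  have hcl : LipschitzWith 1 (fun x : ℝ => max (-V) (min x V)) :=
    (LipschitzWith.id.min_const V).const_max (-V)
  have hfl : LipschitzWith (max 1 K) f := by
    have h := LipschitzWith.prodMk (hcl.comp (LipschitzWith.prod_snd (α := ℝ) (β := ℝ)))
      (hF.comp (LipschitzWith.prod_fst (α := ℝ) (β := ℝ)))
    rw [mul_one, mul_one] at h
    exact h
  have hclb : ∀ x : ℝ, |max (-V) (min x V)| ≤ V := fun x =>
    abs_le.2 ⟨le_max_left _ _, max_le (by linarith) (min_le_right _ _)⟩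
  have hfb : ∀ z, ‖f z‖ ≤ max V B := fun z =>
    max_le_max (by simpa using hclb z.2) (by simpa using hB z.1)
  have h0 : (0 : ℝ) ∈ Icc (-T) T := ⟨by linarith, hT.le⟩
  have hm0 : 0 ≤ max V B := le_max_of_le_right hB0
  have hpl : IsPicardLindelof (fun _ => f) (⟨0, h0⟩ : Icc (-T) T) (a, b)
      (⟨max V B * T, by positivity⟩ : NNReal) 0 ⟨max V B, hm0⟩ (max 1 K) :=
    { lipschitzOnWith := fun _ _ => hfl.lipschitzOnWith
      continuousOn := fun _ _ => continuousOn_const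
      norm_le := fun _ _ z _ => hfb z
      mul_max_le := by simp; exact le_rfl }
  obtain ⟨z, hz0, hz⟩ := hpl.exists_eq_forall_mem_Icc_hasDerivWithinAt₀
  have hzd : ∀ t ∈ Ioo (-T) T, HasDerivAt z (f (z t)) t := fun t ht =>
    (hz t (Ioo_subset_Icc_self ht)).hasDerivAt (Icc_mem_nhds ht.1 ht.2)
  have hz0' : z 0 = (a, b) := hz0
  have hs : ∀ t ∈ Ioo (-T) T, HasDerivAt (fun t => (z t).2) (F (z t).1) t := fun t ht =>
    ((hasFDerivAt_snd (p := z t)).comp_hasDerivAt t (hzd t ht))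
  refine ⟨z, hz0', fun t ht => (hzd t ht).congr_deriv ?_⟩
  have hb : |(z t).2 - b| ≤ B * |t| := by
    have := (convex_Ioo (-T) T).norm_image_sub_le_of_norm_hasDerivWithin_le
      (f := fun t => (z t).2) (C := B)
      (fun t ht => (hs t ht).hasDerivWithinAt) (fun t _ => by simpa using hB _)
      (show (0 : ℝ) ∈ Ioo (-T) T from ⟨by linarith, hT⟩) ht
    simpa [hz0'] using this
  have ht' : |t| ≤ T := abs_le.2 ⟨ht.1.le, ht.2.le⟩
  have hv : |(z t).2| ≤ V := by
    have h1 := abs_sub_abs_le_abs_sub (z t).2 b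
    have h2 := mul_le_mul_of_nonneg_left ht' hB0
    linarith
  have := abs_le.1 hv
  simp only [hf, newtonField]
  rw [min_eq_left this.2, max_eq_right this.1]

/-- Solutions on `(-T, T)` agree by uniqueness. At time `t` the one with `T = |t| + 1` is used; near
`t` all of these coincide with the one for `|t| + 2`, which gives the derivative. -/
theorem exists_newtonSol {F : ℝ → ℝ} {K : NNReal} (hF : LipschitzWith K F) {B : ℝ}
    (hB : ∀ y, |F y| ≤ B) (a b : ℝ) : ∃ y w, IsNewtonSol F y w ∧ y 0 = a ∧ w 0 = b := by
  choose z hz0 hz using fun T : {T : ℝ // 0 < T} => exists_newtonSol_Icc hF hB a b T.2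
  have hagree : ∀ S T : {T : ℝ // 0 < T}, S.1 ≤ T.1 → ∀ t ∈ Ioo (-S.1) S.1, z S t = z T t := by
    intro S T hST t ht
    exact ODE_solution_unique_of_mem_Ioo (v := fun _ => newtonField F) (s := fun _ => univ)
      (t₀ := 0) (fun _ _ => (lipschitzWith_newtonField hF).lipschitzOnWith)
      ⟨by linarith [S.2], S.2⟩ (fun t ht => ⟨hz S t ht, mem_univ _⟩)
      (fun t ht => ⟨hz T t ⟨by linarith [ht.1], by linarith [ht.2]⟩, mem_univ _⟩)
      (by rw [hz0, hz0]) ht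
  have hpos : ∀ t : ℝ, 0 < |t| + 1 := fun t => by positivity
  set Z : ℝ → ℝ × ℝ := fun t => z ⟨|t| + 1, hpos t⟩ t with hZ
  have hZd : ∀ t, HasDerivAt Z (newtonField F (Z t)) t := by
    intro t
    have hT : 0 < |t| + 2 := by positivity
    have key : ∀ s, |s| < |t| + 1 → Z s = z ⟨|t| + 2, hT⟩ s := fun s hs =>
      hagree ⟨|s| + 1, hpos s⟩ ⟨|t| + 2, hT⟩ (by change |s| + 1 ≤ |t| + 2; linarith) s
        (by change s ∈ Ioo (-(|s| + 1)) (|s| + 1)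
            exact abs_lt.1 (by linarith))
    have hd := hz ⟨|t| + 2, hT⟩ t (abs_lt.1 (by change |t| < |t| + 2; linarith))
    rw [key t (by linarith)]
    refine hd.congr_of_eventuallyEq ?_
    filter_upwards [(continuous_abs.tendsto t).eventually (gt_mem_nhds (lt_add_one |t|))] with s hs
    exact key s hs
  refine ⟨fun t => (Z t).1, fun t => (Z t).2, ⟨fun t => ?_, fun t => ?_⟩, ?_, ?_⟩
  · exact (hasFDerivAt_fst (p := Z t)).comp_hasDerivAt t (hZd t)
  · exact (hasFDerivAt_snd (p := Z t)).comp_hasDerivAt t (hZd t)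
  · simp only [hZ, hz0]
  · simp only [hZ, hz0]

/-- Continuous dependence on time and on the initial values. -/
theorem continuous_newtonSol_of_continuous {X : Type*} [TopologicalSpace X] {F : ℝ → ℝ} {K : NNReal}
    (hF : LipschitzWith K F) {y w : X → ℝ → ℝ} (h : ∀ x, IsNewtonSol F (y x) (w x))
    (hy : Continuous fun x => y x 0) (hw : Continuous fun x => w x 0) :
    Continuous fun q : X × ℝ => (y q.1 |q.2|, w q.1 |q.2|) := by
  rw [continuous_iff_continuousAt]
  rintro ⟨x₀, t₀⟩
  rw [ContinuousAt, tendsto_iff_dist_tendsto_zero]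
  have hc0 : Continuous fun x => (y x 0, w x 0) := hy.prodMk hw
  have hct : Continuous fun t => (y x₀ |t|, w x₀ |t|) :=
    ((h x₀).continuous_fst.comp continuous_abs).prodMk ((h x₀).continuous_snd.comp continuous_abs)
  -- Grönwall is available only forward in time, hence the absolute value on the time variable.
  have hlim : Continuous fun q : X × ℝ =>
      dist (y q.1 0, w q.1 0) (y x₀ 0, w x₀ 0) * Real.exp ((max 1 K : NNReal) * |q.2|)
      + dist (y x₀ |q.2|, w x₀ |q.2|) (y x₀ |t₀|, w x₀ |t₀|) := by
    have h1 : Continuous fun q : X × ℝ => (y q.1 0, w q.1 0) := hc0.comp _root_.continuous_fst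
    have h2 : Continuous fun q : X × ℝ => (y x₀ |q.2|, w x₀ |q.2|) := hct.comp _root_.continuous_snd
    have h3 : Continuous fun q : X × ℝ => Real.exp ((max 1 K : NNReal) * |q.2|) := by fun_prop
    exact ((h1.dist continuous_const).mul h3).add (h2.dist continuous_const)
  have hl := hlim.tendsto (x₀, t₀)
  simp only [dist_self, zero_mul, add_zero] at hl
  refine squeeze_zero (fun _ => dist_nonneg) (fun q => ?_) hl
  exact (dist_triangle _ (y x₀ |q.2|, w x₀ |q.2|) _).trans
    (add_le_add_left (IsNewtonSol.dist_le hF (h q.1) (h x₀) (abs_nonneg _)) _)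

/-! ### The truncated nonlinearity and its energy -/

/-- The nonlinearity `y ↦ y - y^(p-1)`, frozen outside `[0, κ]`. -/
def truncForce (p κ y : ℝ) : ℝ := max 0 (min y κ) - max 0 (min y κ) ^ (p - 1)

theorem truncForce_of_mem {p κ y : ℝ} (h0 : 0 ≤ y) (h1 : y ≤ κ) :
    truncForce p κ y = y - y ^ (p - 1) := by
  rw [truncForce, min_eq_left h1, max_eq_right h0]

theorem clamp_mem {κ : ℝ} (hκ : 0 ≤ κ) (y : ℝ) : max 0 (min y κ) ∈ Icc 0 κ :=
  ⟨le_max_left _ _, max_le hκ (min_le_right _ _)⟩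

theorem exists_lipschitzWith_truncForce {p κ : ℝ} (hp : 2 < p) (hκ : 0 ≤ κ) :
    ∃ K : NNReal, LipschitzWith K (truncForce p κ) := by
  have hC : 0 ≤ 1 + (p - 1) * κ ^ (p - 2) := by
    have := Real.rpow_nonneg hκ (p - 2)
    nlinarith
  refine ⟨⟨_, hC⟩, LipschitzWith.of_dist_le_mul fun x y => ?_⟩
  have key := (convex_Icc (0 : ℝ) κ).norm_image_sub_le_of_norm_hasDerivWithin_le
    (f := fun y => y - y ^ (p - 1)) (f' := fun y => 1 - (p - 1) * y ^ (p - 1 - 1))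
    (C := 1 + (p - 1) * κ ^ (p - 2))
    (fun z _ => ((hasDerivAt_id z).sub
      (Real.hasDerivAt_rpow_const (Or.inr (by linarith)))).hasDerivWithinAt)
    (fun z hz => by
      rw [show p - 1 - 1 = p - 2 by ring, Real.norm_eq_abs]
      have h1 : z ^ (p - 2) ≤ κ ^ (p - 2) := Real.rpow_le_rpow hz.1 hz.2 (by linarith)
      have h2 : 0 ≤ z ^ (p - 2) := Real.rpow_nonneg hz.1 _
      rw [abs_le]
      constructor <;> nlinarith)
    (clamp_mem hκ y) (clamp_mem hκ x)
  have hcl : LipschitzWith 1 (fun x : ℝ => max 0 (min x κ)) :=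
    (LipschitzWith.id.min_const κ).const_max 0
  have h2 := hcl.dist_le_mul x y
  rw [NNReal.coe_one, one_mul, Real.dist_eq] at h2
  rw [Real.dist_eq, Real.dist_eq]
  exact key.trans (mul_le_mul_of_nonneg_left h2 hC)

theorem exists_abs_truncForce_le {p κ : ℝ} (hp : 2 < p) (hκ : 0 ≤ κ) :
    ∃ B : ℝ, ∀ y, |truncForce p κ y| ≤ B := by
  refine ⟨κ + κ ^ (p - 1), fun y => ?_⟩
  have h := clamp_mem hκ y
  have h1 : max 0 (min y κ) ^ (p - 1) ≤ κ ^ (p - 1) :=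
    Real.rpow_le_rpow h.1 h.2 (by linarith)
  have h2 : 0 ≤ max 0 (min y κ) ^ (p - 1) := Real.rpow_nonneg h.1 _
  rw [truncForce, abs_le]
  constructor <;> linarith [h.1, h.2]

/-- Twice the primitive of `y ↦ y - y^(p-1)`. -/
def energyPot (p z : ℝ) : ℝ := z ^ 2 - 2 / p * z ^ p

/-- A level above the range of the solutions that matter. -/
def topLevel (p : ℝ) : ℝ := p ^ (1 / (p - 2))

theorem one_lt_topLevel {p : ℝ} (hp : 2 < p) : 1 < topLevel p :=
  Real.one_lt_rpow (by linarith) (by have : 0 < p - 2 := by linarith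
                                     positivity)

theorem hasDerivAt_energyPot {p : ℝ} (hp : 2 < p) (z : ℝ) :
    HasDerivAt (energyPot p) (2 * (z - z ^ (p - 1))) z := by
  have h := ((hasDerivAt_pow 2 z).sub
    ((Real.hasDerivAt_rpow_const (x := z) (p := p) (Or.inr (by linarith))).const_mul (2 / p)))
  refine h.congr_deriv ?_
  have : p ≠ 0 := by linarith
  field_simp
  norm_num
  ring

theorem continuous_energyPot {p : ℝ} (hp : 2 < p) : Continuous (energyPot p) :=
  continuous_iff_continuousAt.2 fun x => (hasDerivAt_energyPot hp x).continuousAt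

theorem energyPot_eq {p z : ℝ} (hz : 0 < z) :
    energyPot p z = z ^ 2 * (1 - 2 / p * z ^ (p - 2)) := by
  rw [energyPot, rpow_eq_sq_mul hz]; ring

/-- The value is negative enough to be a barrier: `w² - energyPot p y` is conserved, so reaching
this height needs an energy of at least `topLevel p ^ 2 > 1`. -/
theorem energyPot_topLevel {p : ℝ} (hp : 2 < p) : energyPot p (topLevel p) = -topLevel p ^ 2 := by
  have h2 : p - 2 ≠ 0 := by linarith
  have hp0 : p ≠ 0 := by linarith
  rw [energyPot_eq (by linarith [one_lt_topLevel hp])]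
  have : topLevel p ^ (p - 2) = p := by
    rw [topLevel, ← Real.rpow_mul (by linarith), one_div_mul_cancel h2, Real.rpow_one]
  rw [this]; field_simp; ring

theorem energyPot_le_sq {p z : ℝ} (hp : 2 < p) (hz : 0 ≤ z) : energyPot p z ≤ z ^ 2 := by
  have : 0 ≤ 2 / p * z ^ p := by positivity
  rw [energyPot]; linarith

theorem energyPot_nonneg {p z : ℝ} (hp : 2 < p) (hz : 0 < z) (h1 : z ≤ 1) :
    0 ≤ energyPot p z := by
  rw [energyPot_eq hz]
  have h : z ^ (p - 2) ≤ 1 := Real.rpow_le_one hz.le h1 (by linarith)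
  have h0 : 0 ≤ z ^ (p - 2) := by positivity
  have h2 : 2 / p ≤ 1 := (div_le_one (by linarith)).2 hp.le
  have h3 : 0 ≤ 2 / p := by positivity
  have : 0 ≤ 1 - 2 / p * z ^ (p - 2) := by nlinarith
  positivity

theorem energyPot_mono {p : ℝ} (hp : 2 < p) : MonotoneOn (energyPot p) (Icc 0 1) := by
  refine monotoneOn_of_deriv_nonneg (convex_Icc 0 1) (continuous_energyPot hp).continuousOn
    (fun z _ => (hasDerivAt_energyPot hp z).differentiableAt.differentiableWithinAt) ?_
  intro z hz
  rw [interior_Icc] at hz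
  rw [(hasDerivAt_energyPot hp z).deriv, rpow_sub_one_eq_mul hz.1]
  have h : z ^ (p - 2) ≤ 1 := Real.rpow_le_one hz.1.le hz.2.le (by linarith)
  nlinarith [hz.1]

namespace IsNewtonSol

variable {p κ : ℝ} {F y w : ℝ → ℝ}

/-- Conservation holds only while `y` stays in `[0, κ]`, where the truncated force is the true one.
-/
theorem energy_eq (hp : 2 < p) (h : IsNewtonSol (truncForce p κ) y w) {a b : ℝ} (hab : a ≤ b)
    (hy : ∀ t ∈ Icc a b, y t ∈ Icc 0 κ) :
    w b ^ 2 - energyPot p (y b) = w a ^ 2 - energyPot p (y a) := by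
  have hd : ∀ t ∈ Icc a b, HasDerivAt (fun t => w t ^ 2 - energyPot p (y t)) 0 t := by
    intro t ht
    have h1 := ((h.deriv_snd t).pow 2).sub
      ((hasDerivAt_energyPot hp (y t)).comp t (h.deriv_fst t))
    refine h1.congr_deriv ?_
    rw [truncForce_of_mem (hy t ht).1 (hy t ht).2]
    norm_num; ring
  have := constant_of_has_deriv_right_zero (f := fun t => w t ^ 2 - energyPot p (y t))
    (fun t ht => (hd t ht).continuousAt.continuousWithinAt)
    (fun t ht => (hd t (Ico_subset_Icc_self ht)).hasDerivWithinAt) b ⟨hab, le_rfl⟩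
  exact this

theorem monotoneOn (h : IsNewtonSol F y w) {a b : ℝ} (hw : ∀ t ∈ Icc a b, 0 ≤ w t) :
    MonotoneOn y (Icc a b) := by
  refine monotoneOn_of_deriv_nonneg (convex_Icc a b) h.continuous_fst.continuousOn
    (fun z _ => (h.deriv_fst z).differentiableAt.differentiableWithinAt) fun t ht => ?_
  rw [(h.deriv_fst t).deriv]
  exact hw t (interior_subset ht)

theorem strictMonoOn (h : IsNewtonSol F y w) {a b : ℝ} (hw : ∀ t ∈ Ioo a b, 0 < w t) :
    StrictMonoOn y (Icc a b) := by
  refine strictMonoOn_of_deriv_pos (convex_Icc a b) h.continuous_fst.continuousOn fun t ht => ?_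
  rw [interior_Icc] at ht
  rw [(h.deriv_fst t).deriv]
  exact hw t ht

/-- An increasing solution stays below the level `topLevel p`. -/
theorem le_topLevel (hp : 2 < p) (h : IsNewtonSol (truncForce p (topLevel p)) y w) {ℓ : ℝ}
    (hw : ∀ t ∈ Icc 0 ℓ, 0 ≤ w t) (h0 : 0 < y 0) (h1 : y 0 ≤ 1) (hs : w 0 ≤ 1) :
    ∀ t ∈ Icc 0 ℓ, y t ∈ Icc (y 0) (topLevel p) := by
  have hm := h.monotoneOn hw
  have hK := one_lt_topLevel hp
  intro t ht
  refine ⟨hm ⟨le_rfl, ht.1.trans ht.2⟩ ht ht.1, ?_⟩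
  by_contra hn
  push Not at hn
  obtain ⟨r, hr, hre⟩ := intermediate_value_Icc ht.1 h.continuous_fst.continuousOn
    (show topLevel p ∈ Icc (y 0) (y t) from ⟨by linarith, hn.le⟩)
  have hrl : r ≤ ℓ := hr.2.trans ht.2
  have he := h.energy_eq hp hr.1 fun q hq => by
    have hq' : q ∈ Icc 0 ℓ := ⟨hq.1, hq.2.trans hrl⟩
    have h2 := hm ⟨le_rfl, ht.1.trans ht.2⟩ hq' hq.1
    have h3 := hm hq' ⟨hr.1, hrl⟩ hq.2
    rw [hre] at h3
    exact ⟨by linarith, h3⟩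
  -- The energy at the barrier is at least `topLevel p ^ 2 > 1`, but at time zero it is at most `w 0
  -- ^ 2 ≤ 1`.
  rw [hre, energyPot_topLevel hp] at he
  have := energyPot_nonneg hp h0 h1
  have hs0 := hw 0 ⟨le_rfl, hr.1.trans hrl⟩
  nlinarith [sq_nonneg (w r)]

end IsNewtonSol

/-! ### Qualitative behaviour: turning time, small convex solutions, first turning point -/

/-- The time in which a solution starting at height `δ` turns is bounded. -/
theorem exists_turning_time {p : ℝ} (hp : 2 < p) {δ s₀ : ℝ} (hδ : 0 < δ) (hδ1 : δ ≤ 1)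
    (hδ2 : δ ^ 2 ≤ (p - 2) / (2 * p)) (hs₀ : 0 < s₀) :
    ∃ T : ℝ, 0 < T ∧ ∀ y w : ℝ → ℝ, IsNewtonSol (truncForce p (topLevel p)) y w → y 0 = δ →
      s₀ ≤ w 0 → w 0 ≤ 1 → ∃ t ∈ Icc 0 T, w t ≤ 0 := by
  have h2 : 0 < p - 2 := by linarith
  have hp0 : 0 < p := by linarith
  -- A level strictly between the equilibrium 1 and the soliton peak: $(p+2)/4$ is halfway between
  -- $1$ and $p/2$. Beyond it the deceleration is at least `c`.
  set b : ℝ := ((p + 2) / 4) ^ (1 / (p - 2)) with hb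
  have hbp : b ^ (p - 2) = (p + 2) / 4 := by
    rw [hb, ← Real.rpow_mul (by linarith), one_div_mul_cancel h2.ne', Real.rpow_one]
  have hb1 : 1 < b := Real.one_lt_rpow (by linarith) (by positivity)
  have hbK : b ≤ topLevel p := Real.rpow_le_rpow (by linarith) (by linarith) (by positivity)
  set K := topLevel p
  set c : ℝ := b * ((p + 2) / 4 - 1) with hc
  have hc0 : 0 < c := by rw [hc]; exact mul_pos (by linarith) (by linarith)
  set t₁ : ℝ := b / s₀ with ht₁
  have ht₁0 : 0 < t₁ := by positivity
  have hK1 : 1 < K := one_lt_topLevel hp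
  -- `t₁` suffices to climb to `b` at speed at least `s₀`, and `(1 + K) / c` to brake from speed at
  -- most `1 + K` to rest.
  refine ⟨t₁ + (1 + K) / c, by positivity, fun y w h hy0 hs hs1 => ?_⟩
  by_contra hcon
  push Not at hcon
  set T := t₁ + (1 + K) / c with hT
  have htT : t₁ ≤ T := by rw [hT]; have : 0 < (1 + K) / c := by positivity
                          linarith
  have hT0 : 0 < T := by linarith
  have hrange := h.le_topLevel hp (fun t ht => (hcon t ht).le) (by linarith) (by linarith) hs1
  have hmono := h.monotoneOn (fun t ht => (hcon t ht).le)
  have henergy : ∀ t ∈ Icc 0 T, w t ^ 2 = w 0 ^ 2 + (energyPot p (y t) - energyPot p δ) := by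
    intro t ht
    have := h.energy_eq hp ht.1 fun r hr => by
      have := hrange r ⟨hr.1, hr.2.trans ht.2⟩
      exact ⟨by linarith [this.1], this.2⟩
    rw [hy0] at this
    linarith
  -- Below `b` the solution is never slower than at the start: the potential increases up to 1, and
  -- on `[1, b]` it stays above `(p - 2) / (2 p) ≥ δ²`.
  have hpot : ∀ z, δ ≤ z → z ≤ b → energyPot p δ ≤ energyPot p z := by
    intro z hz hzb
    rcases le_total z 1 with h1 | h1
    · exact energyPot_mono hp ⟨hδ.le, hδ1⟩ ⟨by linarith, h1⟩ hz
    · have hz0 : 0 < z := by linarith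
      have e1 : z ^ (p - 2) ≤ (p + 2) / 4 := by
        rw [← hbp]; exact Real.rpow_le_rpow hz0.le hzb h2.le
      have e2 : (p - 2) / (2 * p) ≤ 1 - 2 / p * z ^ (p - 2) := by
        have := mul_le_mul_of_nonneg_left e1 (show 0 ≤ 2 / p by positivity)
        have e3 : 2 / p * ((p + 2) / 4) = 1 - (p - 2) / (2 * p) := by field_simp; ring
        linarith
      have e4 : 0 ≤ (p - 2) / (2 * p) := by positivity
      rw [energyPot_eq hz0]
      have e5 := energyPot_le_sq hp hδ.le
      have e6 := mul_le_mul (one_le_pow₀ h1 (n := 2)) e2 e4 (sq_nonneg z)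
      linarith
  have hslow : ∀ t ∈ Icc 0 T, y t ≤ b → s₀ ≤ w t := by
    intro t ht hyb
    have e1 := hpot (y t) (by linarith [(hrange t ht).1]) hyb
    have e2 := henergy t ht
    have e3 := hcon t ht
    nlinarith
  have hreach : b ≤ y t₁ := by
    by_contra hn
    push Not at hn
    have e := (convex_Icc 0 t₁).mul_sub_le_image_sub_of_le_deriv (f := y) (C := s₀)
      h.continuous_fst.continuousOn
      (fun t _ => (h.deriv_fst t).differentiableAt.differentiableWithinAt)
      (fun t ht => by
        have ht' := interior_subset ht
        rw [(h.deriv_fst t).deriv]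
        refine hslow t ⟨ht'.1, ht'.2.trans htT⟩ ?_
        exact (hmono ⟨ht'.1, ht'.2.trans htT⟩ ⟨ht₁0.le, htT⟩ ht'.2).trans hn.le)
      0 ⟨le_rfl, ht₁0.le⟩ t₁ ⟨ht₁0.le, le_rfl⟩ ht₁0.le
    rw [sub_zero, ht₁, mul_div_cancel₀ _ hs₀.ne'] at e
    rw [← ht₁] at e
    linarith
  have hwt : w t₁ ≤ 1 + K := by
    have e := henergy t₁ ⟨ht₁0.le, htT⟩
    have hy := hrange t₁ ⟨ht₁0.le, htT⟩
    have e2 := energyPot_le_sq hp (show 0 ≤ y t₁ by linarith)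
    have e3 := energyPot_nonneg hp hδ hδ1
    have e4 : y t₁ ^ 2 ≤ K ^ 2 := pow_le_pow_left₀ (by linarith) hy.2 2
    nlinarith
  have e := (convex_Icc t₁ T).image_sub_le_mul_sub_of_deriv_le (f := w) (C := -c)
      h.continuous_snd.continuousOn
      (fun t _ => (h.deriv_snd t).differentiableAt.differentiableWithinAt)
      (fun t ht => by
        have ht' := interior_subset ht
        have hm : t ∈ Icc 0 T := ⟨ht₁0.le.trans ht'.1, ht'.2⟩
        have hyb : b ≤ y t := hreach.trans (hmono ⟨ht₁0.le, htT⟩ hm ht'.1)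
        have hy0' : 0 < y t := by linarith
        rw [(h.deriv_snd t).deriv, truncForce_of_mem hy0'.le (hrange t hm).2,
          rpow_sub_one_eq_mul hy0']
        have e1 : (p + 2) / 4 ≤ y t ^ (p - 2) := by
          rw [← hbp]; exact Real.rpow_le_rpow (by linarith) hyb h2.le
        rw [hc]
        nlinarith)
      t₁ ⟨le_rfl, htT⟩ T ⟨htT, le_rfl⟩ htT
  have e2 : -c * (T - t₁) = -(1 + K) := by rw [hT]; field_simp; ring
  rw [e2] at e
  have := hcon T ⟨hT0.le, le_rfl⟩
  linarith

/-- Solutions of the small force: positive initial value, horizontal initial slope. -/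
theorem truncForce_half_nonneg {p : ℝ} (hp : 2 < p) (y : ℝ) : 0 ≤ truncForce p (1 / 2) y := by
  have h := clamp_mem (show (0 : ℝ) ≤ 1 / 2 by norm_num) y
  rw [truncForce]
  rcases h.1.eq_or_lt with h0 | h0
  · rw [← h0, Real.zero_rpow (by linarith), sub_zero]
  · rw [rpow_sub_one_eq_mul h0]
    have := Real.rpow_le_one h.1 (by linarith [h.2]) (show 0 ≤ p - 2 by linarith)
    nlinarith

theorem truncForce_half_pos {p y : ℝ} (hp : 2 < p) (hy : 0 < y) : 0 < truncForce p (1 / 2) y := by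
  have h := clamp_mem (show (0 : ℝ) ≤ 1 / 2 by norm_num) y
  have h0 : 0 < max 0 (min y (1 / 2)) := lt_max_of_lt_right (lt_min hy (by norm_num))
  rw [truncForce, rpow_sub_one_eq_mul h0]
  have := Real.rpow_lt_one h.1 (by linarith [h.2]) (show 0 < p - 2 by linarith)
  nlinarith

theorem truncForce_le_self {p κ y : ℝ} (hy : 0 ≤ y) : truncForce p κ y ≤ y := by
  have h0 : 0 ≤ max 0 (min y κ) ^ (p - 1) := Real.rpow_nonneg (le_max_left _ _) _
  have : max 0 (min y κ) ≤ y := max_le hy (min_le_left _ _)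
  rw [truncForce]; linarith

theorem truncForce_zero {p κ : ℝ} (hp : 2 < p) (hκ : 0 ≤ κ) : truncForce p κ 0 = 0 := by
  rw [truncForce_of_mem le_rfl hκ, Real.zero_rpow (by linarith), sub_zero]

theorem isNewtonSol_zero {p κ : ℝ} (hp : 2 < p) (hκ : 0 ≤ κ) :
    IsNewtonSol (truncForce p κ) (fun _ => 0) (fun _ => 0) where
  deriv_fst _ := hasDerivAt_const _ _
  deriv_snd t := by simpa [truncForce_zero hp hκ] using hasDerivAt_const t (0 : ℝ)

namespace IsNewtonSol

variable {p : ℝ} {y w : ℝ → ℝ}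

/-- The force truncated at 1/2 is nonnegative everywhere, so the solution is convex with horizontal
start. No bound on its size is needed. -/
theorem half_nonneg (hp : 2 < p) (h : IsNewtonSol (truncForce p (1 / 2)) y w) (hw : w 0 = 0) :
    ∀ t, 0 ≤ t → 0 ≤ w t ∧ y 0 ≤ y t := by
  have hwm : Monotone w := monotone_of_deriv_nonneg (fun t => (h.deriv_snd t).differentiableAt)
    fun t => by rw [(h.deriv_snd t).deriv]; exact truncForce_half_nonneg hp _
  have h0 : ∀ t, 0 ≤ t → 0 ≤ w t := fun t ht => hw ▸ hwm ht
  exact fun t ht => ⟨h0 t ht,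
    h.monotoneOn (a := 0) (b := t) (fun r hr => h0 r hr.1) ⟨le_rfl, ht⟩ ⟨ht, le_rfl⟩ ht⟩

theorem half_pos (hp : 2 < p) (h : IsNewtonSol (truncForce p (1 / 2)) y w) (hw : w 0 = 0)
    (hy : 0 < y 0) : ∀ t, 0 < t → 0 < w t := by
  intro t ht
  have hwm : StrictMonoOn w (Icc 0 t) := by
    refine strictMonoOn_of_deriv_pos (convex_Icc 0 t) h.continuous_snd.continuousOn fun r hr => ?_
    have hr' := interior_subset hr
    rw [(h.deriv_snd r).deriv]
    exact truncForce_half_pos hp (by linarith [(h.half_nonneg hp hw r hr'.1).2])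
  rw [← hw]
  exact hwm ⟨le_rfl, ht.le⟩ ⟨ht.le, le_rfl⟩ ht

/-- Since $F(y)\le y$, the quantity $y^2-w^2$ is nondecreasing in forward time, and it starts at
$y(0)^2$. -/
theorem half_le (hp : 2 < p) (h : IsNewtonSol (truncForce p (1 / 2)) y w) (hw : w 0 = 0)
    (hy : 0 ≤ y 0) : ∀ t, 0 ≤ t → w t ≤ y t := by
  intro t ht
  have hm : MonotoneOn (fun t => y t ^ 2 - w t ^ 2) (Icc 0 t) := by
    have hd : ∀ r, HasDerivAt (fun t => y t ^ 2 - w t ^ 2)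
        (2 * w r * (y r - truncForce p (1 / 2) (y r))) r := fun r =>
      (((h.deriv_fst r).pow 2).sub ((h.deriv_snd r).pow 2)).congr_deriv (by norm_num; ring)
    refine monotoneOn_of_deriv_nonneg (convex_Icc 0 t)
      (fun r _ => (hd r).continuousAt.continuousWithinAt)
      (fun r _ => (hd r).differentiableAt.differentiableWithinAt) fun r hr => ?_
    have hr' := interior_subset hr
    rw [(hd r).deriv]
    have e := h.half_nonneg hp hw r hr'.1
    have e2 := truncForce_le_self (p := p) (κ := 1 / 2) (show 0 ≤ y r by linarith)
    exact mul_nonneg (by linarith [e.1]) (by linarith)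
  have e := hm ⟨le_rfl, ht⟩ ⟨ht, le_rfl⟩ ht
  simp only [hw] at e
  have e1 := h.half_nonneg hp hw t ht
  exact le_of_sq_le_sq (by nlinarith) (by linarith)

end IsNewtonSol

theorem truncForce_nonneg_of_le_one {p κ y : ℝ} (hp : 2 < p) (hκ : 0 ≤ κ) (hy : y ≤ 1) :
    0 ≤ truncForce p κ y := by
  have h := clamp_mem hκ y
  have h1 : max 0 (min y κ) ≤ 1 := max_le zero_le_one ((min_le_left _ _).trans hy)
  rw [truncForce]
  rcases h.1.eq_or_lt with h0 | h0
  · rw [← h0, Real.zero_rpow (by linarith), sub_zero]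
  · rw [rpow_sub_one_eq_mul h0]
    have := Real.rpow_le_one h.1 h1 (show 0 ≤ p - 2 by linarith)
    nlinarith

theorem eq_one_of_sub_rpow_eq_zero {p z : ℝ} (hp : 2 < p) (hz : 0 < z)
    (h : z - z ^ (p - 1) = 0) : z = 1 := by
  rw [rpow_sub_one_eq_mul hz] at h
  have h1 : z ^ (p - 2) = 1 := by
    have : z * (1 - z ^ (p - 2)) = 0 := by linarith
    rcases mul_eq_zero.1 this with h | h <;> linarith
  rcases lt_trichotomy z 1 with h2 | h2 | h2
  · exact absurd h1 (Real.rpow_lt_one hz.le h2 (by linarith)).ne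
  · exact h2
  · exact absurd h1 (Real.one_lt_rpow h2 (by linarith)).ne'

theorem energyPot_one {p : ℝ} (hp : 2 < p) : energyPot p 1 = (p - 2) / p := by
  have : p ≠ 0 := by linarith
  rw [energyPot, Real.one_rpow]; field_simp

/-- Decodes a zero of the shooting function; the infimum is attained because the interval is
compact. -/
theorem exists_zero_of_min_eq_zero {f : ℝ → ℝ} {a b ℓ : ℝ} (hℓ : 0 ≤ ℓ)
    (hf : Continuous f) (h : min (a - b) (sInf (f '' Icc 0 ℓ)) = 0) :
    b ≤ a ∧ (∀ t ∈ Icc 0 ℓ, 0 ≤ f t) ∧ (b = a ∨ ∃ t ∈ Icc 0 ℓ, f t = 0) := by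
  have h1 : 0 ≤ a - b := h.symm.trans_le (min_le_left _ _)
  have h2 : 0 ≤ sInf (f '' Icc 0 ℓ) := h.symm.trans_le (min_le_right _ _)
  refine ⟨by linarith, fun t ht => h2.trans (csInf_le
    (isCompact_Icc.bddBelow_image hf.continuousOn) (mem_image_of_mem f ht)), ?_⟩
  rcases min_choice (a - b) (sInf (f '' Icc 0 ℓ)) with h3 | h3
  · left; linarith
  · right
    obtain ⟨t, ht, hte⟩ := isCompact_Icc.exists_sInf_image_eq (nonempty_Icc.2 hℓ) hf.continuousOn
    exact ⟨t, ht, by rw [← hte, ← h3, h]⟩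

/-- A nondecreasing solution of small initial data can stop only at a turning point. -/
theorem IsNewtonSol.pos_of_lt {p ℓ : ℝ} (hp : 2 < p) {y w : ℝ → ℝ}
    (h : IsNewtonSol (truncForce p (topLevel p)) y w) (hw : ∀ t ∈ Icc 0 ℓ, 0 ≤ w t)
    (hy0 : 0 < y 0) (hy1 : y 0 ≤ 1) (hy2 : y 0 ^ 2 ≤ (p - 2) / (2 * p)) (hw0 : 0 < w 0)
    (hw1 : w 0 ≤ 1) : ∀ t ∈ Ico 0 ℓ, 0 < w t := by
  intro t ht
  refine (hw t (Ico_subset_Icc_self ht)).lt_of_ne fun h0 => ?_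
  have ht0 : 0 < t := ht.1.lt_of_ne (by rintro rfl; linarith)
  -- An interior zero of the nonnegative slope is a minimum, so the force vanishes there and the
  -- height is the equilibrium 1. The energy excludes this: the potential at 1 is `(p - 2) / p`,
  -- while at the start it is at most half of that.
  have hmin : IsLocalMin w t := by
    filter_upwards [Icc_mem_nhds ht0 ht.2] with r hr
    rw [← h0]; exact hw r hr
  have hr := h.le_topLevel hp hw hy0 hy1 hw1
  have hrt := hr t (Ico_subset_Icc_self ht)
  have e := hmin.hasDerivAt_eq_zero (h.deriv_snd t)
  rw [truncForce_of_mem (by linarith [hrt.1]) hrt.2] at e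
  have e1 := eq_one_of_sub_rpow_eq_zero hp (by linarith [hrt.1]) e
  have e2 := h.energy_eq hp ht.1 fun r hr' => by
    have := hr r ⟨hr'.1, hr'.2.trans ht.2.le⟩
    exact ⟨by linarith [this.1], this.2⟩
  rw [← h0, e1, energyPot_one hp] at e2
  have e3 := energyPot_le_sq hp hy0.le
  have e4 : (p - 2) / (2 * p) < (p - 2) / p := by
    have : 0 < (p - 2) / (2 * p) := div_pos (by linarith) (by linarith)
    have e5 : (p - 2) / p = 2 * ((p - 2) / (2 * p)) := by
      have : p ≠ 0 := by linarith
      field_simp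
    linarith
  nlinarith [sq_nonneg (w 0)]

/-! ### Flux condition and shooting -/

/-- The slope that the flux condition prescribes on each of the `E` edges that carry a bump. -/
def fluxSlope (p E H N δ d : ℝ) : ℝ := (H * (δ * √(1 - 2 / p * δ ^ (p - 2))) + N * d) / E

theorem fluxSlope_le {p E H N δ d : ℝ} (hp : 2 < p) (hE : 0 < E) (hH : 0 < H) (hN : 0 ≤ N)
    (hδ : 0 ≤ δ) (hd : d ≤ δ) : fluxSlope p E H N δ d ≤ (H + N) / E * δ := by
  have h0 : 0 ≤ 2 / p * δ ^ (p - 2) := by positivity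
  have h1 : √(1 - 2 / p * δ ^ (p - 2)) ≤ 1 := Real.sqrt_le_one.2 (by linarith)
  have h2 : δ * √(1 - 2 / p * δ ^ (p - 2)) ≤ δ := mul_le_of_le_one_right hδ h1
  rw [fluxSlope, show (H + N) / E * δ = ((H + N) * δ) / E by ring]
  exact div_le_div_of_nonneg_right (by nlinarith) hE.le

/-- The half-lines alone contribute this much. The bound does not involve `ℓ`, so it yields a
turning time independent of the length of the graph. -/
theorem le_fluxSlope {p E H N δ d : ℝ} (hp : 2 < p) (hE : 0 < E) (hH : 0 < H) (hN : 0 ≤ N)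
    (hδ : 0 ≤ δ) (hδ1 : δ ≤ 1) (hd : 0 ≤ d) :
    H * (δ * √(1 - 2 / p)) / E ≤ fluxSlope p E H N δ d := by
  have h0 : δ ^ (p - 2) ≤ 1 := Real.rpow_le_one hδ hδ1 (by linarith)
  have h1 : √(1 - 2 / p) ≤ √(1 - 2 / p * δ ^ (p - 2)) := by
    refine Real.sqrt_le_sqrt ?_
    have := mul_le_of_le_one_right (show 0 ≤ 2 / p by positivity) h0
    linarith
  have h2 := mul_le_mul_of_nonneg_left (mul_le_mul_of_nonneg_left h1 hδ) hH.le
  have h3 := mul_nonneg hN hd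
  rw [fluxSlope, div_le_div_iff_of_pos_right hE]
  linarith

/-- The shooting argument. -/
theorem exists_shooting {p : ℝ} (hp : 2 < p) {E H N : ℝ} (hE : 0 < E) (hH : 0 < H) (hN : 0 ≤ N)
    {δ₁ : ℝ} (h0 : 0 < δ₁) (h1 : δ₁ ≤ 1 / 2) (h2 : δ₁ ^ 2 ≤ (p - 2) / (2 * p))
    (h3 : (H + N) / E * δ₁ ≤ 1) :
    ∃ ℓ₀ : ℝ, 0 < ℓ₀ ∧ ∀ ℓ, ℓ₀ ≤ ℓ → ∃ y w Z W : ℝ → ℝ,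
      IsNewtonSol (truncForce p (1 / 2)) y w ∧ IsNewtonSol (truncForce p (topLevel p)) Z W ∧
      0 < y 0 ∧ w 0 = 0 ∧ Z 0 = y ℓ ∧ y ℓ ≤ δ₁ ∧ W 0 = fluxSlope p E H N (y ℓ) (w ℓ) ∧
      0 < W 0 ∧ W ℓ = 0 ∧ ∀ t ∈ Ico 0 ℓ, 0 < W t := by
  have hp0 : 0 < p := by linarith
  have hsq : 0 < √(1 - 2 / p) := Real.sqrt_pos.2 (by
    rw [sub_pos, div_lt_one hp0]; exact hp)
  obtain ⟨T, hT0, hT⟩ := exists_turning_time hp h0 (by linarith) h2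
    (show 0 < H * (δ₁ * √(1 - 2 / p)) / E by positivity)
  refine ⟨T, hT0, fun ℓ hℓ => ?_⟩
  have hℓ0 : 0 < ℓ := hT0.trans_le hℓ
  have hKnn : 0 ≤ topLevel p := by linarith [one_lt_topLevel hp]
  obtain ⟨K₁, hK₁⟩ := exists_lipschitzWith_truncForce (κ := 1 / 2) hp (by norm_num)
  obtain ⟨B₁, hB₁⟩ := exists_abs_truncForce_le (κ := 1 / 2) hp (by norm_num)
  obtain ⟨K₂, hK₂⟩ := exists_lipschitzWith_truncForce hp hKnn
  obtain ⟨B₂, hB₂⟩ := exists_abs_truncForce_le hp hKnn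
  -- The shooting parameter `m` is the height at the far end of the edges without a bump; time runs
  -- from there towards the vertex.
  choose y w hyw hy0 hw0 using fun m : ℝ => exists_newtonSol hK₁ hB₁ m 0
  have hc₁ := continuous_newtonSol_of_continuous hK₁ hyw
    (by simp only [hy0]; exact continuous_id) (by simp only [hw0]; exact continuous_const)
  have hcy : Continuous fun m => y m ℓ := by
    have := (hc₁.comp (Continuous.prodMk_left ℓ)).fst
    simpa only [Function.comp_apply, abs_of_pos hℓ0] using this
  have hcw : Continuous fun m => w m ℓ := by
    have := (hc₁.comp (Continuous.prodMk_left ℓ)).snd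
    simpa only [Function.comp_apply, abs_of_pos hℓ0] using this
  have hcs : Continuous fun m => fluxSlope p E H N (y m ℓ) (w m ℓ) := by
    have : Continuous fun m => y m ℓ ^ (p - 2) := hcy.rpow_const fun _ => Or.inr (by linarith)
    unfold fluxSlope
    fun_prop
  choose Z W hZW hZ0 hW0 using fun m : ℝ =>
    exists_newtonSol hK₂ hB₂ (y m ℓ) (fluxSlope p E H N (y m ℓ) (w m ℓ))
  have hc₂ := continuous_newtonSol_of_continuous hK₂ hZW
    (by simpa only [hZ0] using hcy) (by simpa only [hW0] using hcs)
  have hcW : ∀ m, Continuous fun t => W m |t| := fun m =>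
    (hZW m).continuous_snd.comp continuous_abs
  -- Positive exactly when the vertex value is below `δ₁` and the bump is strictly rising on all of
  -- `[0, ℓ]`.
  set g : ℝ → ℝ := fun m => min (δ₁ - y m ℓ) (sInf ((fun t => W m |t|) '' Icc 0 ℓ)) with hg
  have hgc : Continuous g :=
    (continuous_const.sub hcy).min (isCompact_Icc.continuous_sInf
      (f := fun m t => W m |t|) hc₂.snd)
  have hypos : ∀ m, 0 < m → m ≤ y m ℓ ∧ 0 ≤ w m ℓ ∧ w m ℓ ≤ y m ℓ := fun m hm => by
    have e1 := (hyw m).half_nonneg hp (hw0 m) ℓ hℓ0.le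
    rw [hy0] at e1
    exact ⟨e1.2, e1.1, (hyw m).half_le hp (hw0 m) (by rw [hy0]; exact hm.le) ℓ hℓ0.le⟩
  have hslope : ∀ m, 0 < m → y m ℓ ≤ 1 → 0 < W m 0 ∧ W m 0 ≤ (H + N) / E * y m ℓ := by
    intro m hm hle
    obtain ⟨e1, e2, e3⟩ := hypos m hm
    have hd : 0 < y m ℓ := by linarith
    have e4 := le_fluxSlope (d := w m ℓ) hp hE hH hN hd.le hle e2
    rw [hW0]
    exact ⟨lt_of_lt_of_le (by positivity) e4, fluxSlope_le hp hE hH hN hd.le e3⟩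
  have hgle : g δ₁ ≤ 0 := (min_le_left _ _).trans (by linarith [(hypos δ₁ h0).1])
  set c := (H + N) / E with hc
  have hc0 : 0 < c := by positivity
  set L₁ := Real.exp ((max 1 K₁ : NNReal) * ℓ) with hL₁
  set L₂ := Real.exp ((max 1 K₂ : NNReal) * ℓ) with hL₂
  have hL₁1 : 1 ≤ L₁ := Real.one_le_exp (by positivity)
  have hL₂1 : 1 ≤ L₂ := Real.one_le_exp (by positivity)
  -- Small enough to survive two Grönwall factors, `L₁` along the small solution and `L₂` along the
  -- bump, with `1 + c` bounding the initial slope. Then `Z ≤ 1` on `[0, ℓ]`, so `Z` is convex and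
  -- keeps rising.
  set m₀ := δ₁ / (2 * ((1 + c) * L₂ * L₁)) with hm₀
  have hm₀0 : 0 < m₀ := by positivity
  have hden : 1 ≤ (1 + c) * L₂ := by nlinarith
  have hyb : y m₀ ℓ * ((1 + c) * L₂) ≤ δ₁ / 2 := by
    have e := IsNewtonSol.dist_le hK₁ (hyw m₀) (isNewtonSol_zero hp (by norm_num)) hℓ0.le
    simp only [Prod.dist_eq, Real.dist_eq, sub_zero, hy0, hw0, abs_zero] at e
    rw [max_eq_left (abs_nonneg m₀), abs_of_pos hm₀0, ← hL₁] at e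
    have e1 := (le_abs_self _).trans ((le_max_left _ _).trans e)
    have e2 := mul_le_mul_of_nonneg_right e1 (show 0 ≤ (1 + c) * L₂ by positivity)
    refine e2.trans_eq ?_
    rw [hm₀]; field_simp
  have hy₀pos := (hypos m₀ hm₀0).1
  have hyle : y m₀ ℓ ≤ δ₁ / 2 := by nlinarith
  have hm₀le : m₀ ≤ δ₁ := by linarith
  have hgpos : 0 < g m₀ := by
    obtain ⟨hs0, hs1⟩ := hslope m₀ hm₀0 (by linarith)
    obtain ⟨t, ht, hte⟩ := isCompact_Icc.exists_sInf_image_eq (nonempty_Icc.2 hℓ0.le)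
      (hcW m₀).continuousOn
    refine lt_min (by linarith) ?_
    rw [hte, abs_of_nonneg ht.1]
    have hZle : ∀ r ∈ Icc 0 ℓ, Z m₀ r ≤ 1 := by
      intro r hr
      have e := IsNewtonSol.dist_le hK₂ (hZW m₀) (isNewtonSol_zero hp hKnn) hr.1
      simp only [Prod.dist_eq, Real.dist_eq, sub_zero, hZ0] at e
      rw [abs_of_pos (by linarith : 0 < y m₀ ℓ), abs_of_pos hs0] at e
      have e1 := (le_abs_self _).trans ((le_max_left _ _).trans e)
      have e2 : max (y m₀ ℓ) (W m₀ 0) ≤ y m₀ ℓ * (1 + c) := max_le (by nlinarith) (by nlinarith)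
      have e3 : Real.exp ((max 1 K₂ : NNReal) * r) ≤ L₂ :=
        Real.exp_le_exp.2 (mul_le_mul_of_nonneg_left hr.2 (by positivity))
      have e4 : max (y m₀ ℓ) (W m₀ 0) * Real.exp ((max 1 K₂ : NNReal) * r)
          ≤ y m₀ ℓ * (1 + c) * L₂ :=
        mul_le_mul e2 e3 (Real.exp_pos _).le (mul_nonneg (by linarith) (by linarith))
      linarith
    have hmono : MonotoneOn (W m₀) (Icc 0 ℓ) := by
      refine monotoneOn_of_deriv_nonneg (convex_Icc 0 ℓ) (hZW m₀).continuous_snd.continuousOn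
        (fun r _ => ((hZW m₀).deriv_snd r).differentiableAt.differentiableWithinAt) fun r hr => ?_
      rw [((hZW m₀).deriv_snd r).deriv]
      exact truncForce_nonneg_of_le_one hp hKnn (hZle r (interior_subset hr))
    exact hs0.trans_le (hmono ⟨le_rfl, hℓ0.le⟩ ht ht.1)
  obtain ⟨m, hm, hgm⟩ := intermediate_value_Icc' hm₀le hgc.continuousOn
    (show (0 : ℝ) ∈ Icc (g δ₁) (g m₀) from ⟨hgle, hgpos.le⟩)
  have hm0 : 0 < m := hm₀0.trans_le hm.1
  obtain ⟨k1, k2, k3⟩ := exists_zero_of_min_eq_zero hℓ0.le (hcW m) hgm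
  have k2' : ∀ t ∈ Icc 0 ℓ, 0 ≤ W m t := fun t ht => by
    have := k2 t ht
    rwa [abs_of_nonneg ht.1] at this
  obtain ⟨e1, e2, e3⟩ := hypos m hm0
  obtain ⟨hs0, hs1⟩ := hslope m hm0 (by linarith)
  have hs1' : W m 0 ≤ 1 := by nlinarith
  have hZ0pos : 0 < Z m 0 := by rw [hZ0]; linarith
  have hpos := (hZW m).pos_of_lt hp k2' hZ0pos (by rw [hZ0]; linarith)
    (by rw [hZ0]; exact (pow_le_pow_left₀ (by linarith) k1 2).trans h2) hs0 hs1'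
  -- If the vertex value is `δ₁`, the turning time is at most `T ≤ ℓ` and forces a zero of the
  -- slope; otherwise the minimum of the slope is itself zero. In both cases `hpos` places the zero
  -- at `ℓ`.
  obtain ⟨t, ht, htz⟩ : ∃ t ∈ Icc 0 ℓ, W m t = 0 := by
    rcases k3 with k3 | ⟨t, ht, hte⟩
    · obtain ⟨t, ht, hte⟩ := hT (Z m) (W m) (hZW m) (by rw [hZ0, k3])
        (by have := le_fluxSlope (d := w m ℓ) hp hE hH hN (show 0 ≤ y m ℓ by linarith)
              (by linarith) e2
            rw [hW0]; rwa [k3] at this ⊢) hs1'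
      have ht' : t ∈ Icc 0 ℓ := ⟨ht.1, ht.2.trans hℓ⟩
      exact ⟨t, ht', le_antisymm hte (k2' t ht')⟩
    · exact ⟨t, ht, by rwa [abs_of_nonneg ht.1] at hte⟩
  have htℓ : t = ℓ := by
    by_contra hne
    exact (hpos t ⟨ht.1, lt_of_le_of_ne ht.2 hne⟩).ne' htz
  subst htℓ
  exact ⟨y m, w m, Z m, W m, hyw m, hZW m, by rw [hy0]; exact hm0, hw0 m, hZ0 m, k1, hW0 m, hs0,
    htz, hpos⟩

/-! ### Tail estimates and closeness of the bump to the soliton -/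

/-- The convexity constant of solutions below the level `1/2`. -/
def tailRate (p : ℝ) : ℝ := 1 - (1 / 2) ^ (p - 2)

theorem tailRate_pos {p : ℝ} (hp : 2 < p) : 0 < tailRate p :=
  sub_pos.2 (Real.rpow_lt_one (by norm_num) (by norm_num) (by linarith))

theorem continuous_truncForce {p κ : ℝ} (hp : 2 < p) (hκ : 0 ≤ κ) : Continuous (truncForce p κ) :=
  (exists_lipschitzWith_truncForce hp hκ).choose_spec.continuous

/-- While $0<y\le\frac12$, $y''=y(1-y^{p-2})\ge c\,y\ge c\,y^p$; integrating $y''$ leaves a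
difference of slopes. The bound does not depend on the length of the interval. -/
theorem IsNewtonSol.integral_rpow_le {p κ : ℝ} {y w : ℝ → ℝ} (hp : 2 < p) (hκ : 1 / 2 ≤ κ)
    (h : IsNewtonSol (truncForce p κ) y w) {a b : ℝ} (hab : a ≤ b)
    (hy : ∀ t ∈ Icc a b, 0 < y t ∧ y t ≤ 1 / 2) :
    ∫ t in a..b, y t ^ p ≤ (w b - w a) / tailRate p := by
  have hc := tailRate_pos hp
  have hcF : Continuous fun t => truncForce p κ (y t) :=
    (continuous_truncForce hp (by linarith)).comp h.continuous_fst
  have hint : IntervalIntegrable (fun t => truncForce p κ (y t)) volume a b :=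
    hcF.intervalIntegrable _ _
  have hcp : Continuous fun t => y t ^ p :=
    h.continuous_fst.rpow_const fun _ => Or.inr (by linarith)
  rw [le_div_iff₀ hc, ← intervalIntegral.integral_eq_sub_of_hasDerivAt
    (fun t _ => h.deriv_snd t) hint, ← intervalIntegral.integral_mul_const]
  refine intervalIntegral.integral_mono_on hab ((hcp.mul continuous_const).intervalIntegrable _ _)
    hint fun t ht => ?_
  obtain ⟨h0, h1⟩ := hy t ht
  rw [truncForce_of_mem h0.le (h1.trans hκ), rpow_sub_one_eq_mul h0]
  have e1 : y t ^ p ≤ y t := by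
    have := Real.rpow_le_rpow_of_exponent_ge h0 (by linarith) (show 1 ≤ p by linarith)
    rwa [Real.rpow_one] at this
  have e2 : y t ^ (p - 2) ≤ (1 / 2) ^ (p - 2) := Real.rpow_le_rpow h0.le h1 (by linarith)
  calc y t ^ p * tailRate p ≤ y t * tailRate p := mul_le_mul_of_nonneg_right e1 hc.le
    _ ≤ y t - y t * y t ^ (p - 2) := by rw [tailRate]; nlinarith

theorem soliton_le_topLevel {p : ℝ} (hp : 2 < p) (x : ℝ) : soliton p x ≤ topLevel p := by
  refine (soliton_le_zero hp x).trans ?_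
  rw [soliton_zero, topLevel]
  exact Real.rpow_le_rpow (by linarith) (by linarith)
    (by have : 0 < p - 2 := by linarith
        positivity)

theorem isNewtonSol_soliton {p : ℝ} (hp : 2 < p) :
    IsNewtonSol (truncForce p (topLevel p)) (soliton p) (solitonDeriv p) where
  deriv_fst t := hasDerivAt_soliton hp t
  deriv_snd t := by
    rw [truncForce_of_mem (soliton_pos hp t).le (soliton_le_topLevel hp t)]
    exact hasDerivAt_solitonDeriv hp t

theorem integral_Ioi_soliton_le {p a : ℝ} (hp : 2 < p) (ha : 0 ≤ a) (h : soliton p a ≤ 1 / 2) :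
    ∫ x in Ioi a, soliton p x ^ p ≤ soliton p a / tailRate p := by
  refine le_of_tendsto (intervalIntegral_tendsto_integral_Ioi a
    (integrable_soliton_rpow hp).integrableOn Filter.tendsto_id) ?_
  filter_upwards [Filter.eventually_ge_atTop a, Filter.eventually_gt_atTop 0] with b hab hb
  have hK := one_lt_topLevel hp
  refine ((isNewtonSol_soliton hp).integral_rpow_le hp (by linarith) hab fun t ht =>
    ⟨soliton_pos hp t, ((strictAntiOn_soliton hp).antitoneOn ha (ha.trans ht.1) ht.1).trans h⟩).trans
    ?_
  refine div_le_div_of_nonneg_right ?_ (tailRate_pos hp).le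
  have e1 := solitonDeriv_neg_of_pos hp hb
  have e2 := (abs_le.1 (abs_solitonDeriv_le hp a)).1
  linarith

/-- The soliton peak is the zero of `energyPot p` on $[1,\infty)$. There $x=1-\frac2pM^{p-2}$
satisfies $|x|\le|{\rm energyPot}(M)|$, and $M$ is a continuous function of $x$ near $0$. -/
theorem exists_near_soliton_zero {p η : ℝ} (hp : 2 < p) (hη : 0 < η) :
    ∃ ρ : ℝ, 0 < ρ ∧ ∀ M, 1 ≤ M → |energyPot p M| ≤ ρ → |M - soliton p 0| ≤ η := by
  have hc : ContinuousAt (fun x : ℝ => (p / 2 * (1 - x)) ^ (1 / (p - 2))) 0 := by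
    have : 0 < p - 2 := by linarith
    exact ContinuousAt.rpow_const (by fun_prop) (Or.inr (by positivity))
  obtain ⟨r, hr, hr'⟩ := Metric.continuousAt_iff.1 hc η hη
  refine ⟨r / 2, by positivity, fun M hM hE => ?_⟩
  have hM0 : 0 < M := by linarith
  have h2 : p - 2 ≠ 0 := by linarith
  have hp0 : p ≠ 0 := by linarith
  have e := energyPot_eq (p := p) hM0
  set x := 1 - 2 / p * M ^ (p - 2) with hx
  have hxr : |x| < r := by
    rw [e, abs_mul, abs_of_pos (by positivity : 0 < M ^ 2)] at hE
    have h1 : 1 ≤ M ^ 2 := one_le_pow₀ hM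
    have := mul_le_mul_of_nonneg_right h1 (abs_nonneg x)
    linarith
  have h3 := hr' (x := x) (by simpa using hxr)
  have e2 : (p / 2 * (1 - x)) ^ (1 / (p - 2)) = M := by
    have : p / 2 * (1 - x) = M ^ (p - 2) := by rw [hx]; field_simp; ring
    rw [this, ← Real.rpow_mul hM0.le, mul_one_div_cancel h2, Real.rpow_one]
  simp only [e2, sub_zero, mul_one] at h3
  rw [soliton_zero]
  exact h3.le

theorem abs_rpow_sub_rpow_le {p K x y : ℝ} (hp : 2 < p) (hx : x ∈ Icc 0 K) (hy : y ∈ Icc 0 K) :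
    |x ^ p - y ^ p| ≤ p * K ^ (p - 1) * |x - y| := by
  refine (convex_Icc (0 : ℝ) K).norm_image_sub_le_of_norm_hasDerivWithin_le
    (f := fun y => y ^ p) (f' := fun y => p * y ^ (p - 1))
    (fun z _ => (Real.hasDerivAt_rpow_const (Or.inr (by linarith))).hasDerivWithinAt)
    (fun z hz => ?_) hy hx
  have h1 : z ^ (p - 1) ≤ K ^ (p - 1) := Real.rpow_le_rpow hz.1 hz.2 (by linarith)
  have h2 : 0 ≤ z ^ (p - 1) := Real.rpow_nonneg hz.1 _
  rw [Real.norm_eq_abs, abs_of_nonneg (by nlinarith)]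
  nlinarith

/-- The maximum of a bump is at least one. -/
theorem IsNewtonSol.one_le_max {p ℓ : ℝ} (hp : 2 < p) (hℓ : 0 ≤ ℓ) {y w : ℝ → ℝ}
    (h : IsNewtonSol (truncForce p (topLevel p)) y w) (hw : ∀ t ∈ Icc 0 ℓ, 0 ≤ w t)
    (hw0 : 0 < w 0) (hwℓ : w ℓ = 0) : 1 ≤ y ℓ := by
  by_contra hn
  push Not at hn
  have hm := h.monotoneOn hw
  have hmono : MonotoneOn w (Icc 0 ℓ) := by
    refine monotoneOn_of_deriv_nonneg (convex_Icc 0 ℓ) h.continuous_snd.continuousOn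
      (fun r _ => (h.deriv_snd r).differentiableAt.differentiableWithinAt) fun r hr => ?_
    have hr' := interior_subset hr
    rw [(h.deriv_snd r).deriv]
    exact truncForce_nonneg_of_le_one hp (by linarith [one_lt_topLevel hp])
      ((hm hr' ⟨hℓ, le_rfl⟩ hr'.2).trans hn.le)
  have := hmono ⟨le_rfl, hℓ⟩ ⟨hℓ, le_rfl⟩ hℓ
  linarith

theorem abs_add_sub_add_le {a₁ a₂ a₃ a₄ x y : ℝ} (h₁ : |a₁ - a₂| ≤ x) (h₃ : 0 ≤ a₃) (h₃' : a₃ ≤ y)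
    (h₄ : 0 ≤ a₄) (h₄' : a₄ ≤ y) : |a₁ + a₃ - (a₂ + a₄)| ≤ x + y := by
  have := abs_le.1 h₁
  rw [abs_le]
  constructor <;> linarith [this.1, this.2]

/-- Split at distance `R` from the peak. Near the peak, $z\mapsto z^p$ is Lipschitz below `topLevel
p`; beyond, both integrals are tails and are bounded through their slopes. -/
theorem IsNewtonSol.abs_integral_sub_soliton_le {p R ℓ η σ : ℝ} (hp : 2 < p) (hR0 : 0 < R)
    (hℓ : R ≤ ℓ) {Z W : ℝ → ℝ} (h : IsNewtonSol (truncForce p (topLevel p)) Z W)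
    (hrange : ∀ t ∈ Icc 0 ℓ, 0 < Z t ∧ Z t ≤ topLevel p) (hW0 : 0 ≤ W 0)
    (hdist : ∀ t ∈ Icc 0 R, |Z (ℓ - t) - soliton p t| ≤ η ∧ |-W (ℓ - t) - solitonDeriv p t| ≤ η)
    (hztail : ∀ t ∈ Icc R ℓ, 0 < Z (ℓ - t) ∧ Z (ℓ - t) ≤ σ + σ) (hR : soliton p R ≤ σ)
    (hσ : σ ≤ 1 / 4) (hησ : η ≤ σ) :
    |(∫ t in (0 : ℝ)..ℓ, Z t ^ p) - ∫ t in Ioi 0, soliton p t ^ p|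
      ≤ R * (p * topLevel p ^ (p - 1) * η) + (σ + σ) / tailRate p := by
  have hK1 := one_lt_topLevel hp
  have hσ0 : 0 < σ := (soliton_pos hp R).trans_le hR
  have hz := h.comp_sub_left ℓ
  have hRmem : R ∈ Icc 0 R := ⟨hR0.le, le_rfl⟩
  have hzmem : ∀ t ∈ Icc 0 ℓ, ℓ - t ∈ Icc 0 ℓ := fun t ht => ⟨by linarith [ht.2], by linarith [ht.1]⟩
  have hcz : Continuous fun t => Z (ℓ - t) ^ p :=
    hz.continuous_fst.rpow_const fun _ => Or.inr (by linarith)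
  have hcs : Continuous fun t => soliton p t ^ p :=
    (continuous_soliton hp).rpow_const fun _ => Or.inr (by linarith)
  have e0 : ∫ t in (0 : ℝ)..ℓ, Z t ^ p = ∫ t in (0 : ℝ)..ℓ, Z (ℓ - t) ^ p := by
    rw [intervalIntegral.integral_comp_sub_left (fun t => Z t ^ p), sub_self, sub_zero]
  have e1 : ∫ t in (0 : ℝ)..ℓ, Z (ℓ - t) ^ p
      = (∫ t in (0 : ℝ)..R, Z (ℓ - t) ^ p) + ∫ t in R..ℓ, Z (ℓ - t) ^ p :=
    (intervalIntegral.integral_add_adjacent_intervals (hcz.intervalIntegrable _ _)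
      (hcz.intervalIntegrable _ _)).symm
  have e2 : ∫ t in Ioi 0, soliton p t ^ p
      = (∫ t in (0 : ℝ)..R, soliton p t ^ p) + ∫ t in Ioi R, soliton p t ^ p :=
    (intervalIntegral.integral_interval_add_Ioi (integrable_soliton_rpow hp).integrableOn
      (integrable_soliton_rpow hp).integrableOn).symm
  have e3 : |(∫ t in (0 : ℝ)..R, Z (ℓ - t) ^ p) - ∫ t in (0 : ℝ)..R, soliton p t ^ p|
      ≤ R * ((p * topLevel p ^ (p - 1)) * η) := by
    rw [← intervalIntegral.integral_sub (hcz.intervalIntegrable _ _)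
      (hcs.intervalIntegrable _ _)]
    have := intervalIntegral.norm_integral_le_of_norm_le_const (a := 0) (b := R)
      (f := fun t => Z (ℓ - t) ^ p - soliton p t ^ p) (C := (p * topLevel p ^ (p - 1)) * η) (fun t ht => by
        rw [uIoc_of_le hR0.le] at ht
        have ht' : t ∈ Icc 0 R := Ioc_subset_Icc_self ht
        have hm := hrange _ (hzmem t ⟨ht'.1, ht'.2.trans hℓ⟩)
        exact (abs_rpow_sub_rpow_le hp ⟨hm.1.le, hm.2⟩
          ⟨(soliton_pos hp t).le, soliton_le_topLevel hp t⟩).trans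
          (mul_le_mul_of_nonneg_left (hdist t ht').1 (by positivity)))
    rw [sub_zero, abs_of_pos hR0] at this
    rw [mul_comm]; exact this
  have e4 : ∫ t in R..ℓ, Z (ℓ - t) ^ p ≤ (σ + σ) / tailRate p := by
    refine (hz.integral_rpow_le hp (by linarith) hℓ fun t ht =>
      ⟨(hztail t ht).1, by linarith [(hztail t ht).2]⟩).trans ?_
    refine div_le_div_of_nonneg_right ?_ (tailRate_pos hp).le
    -- The slope at distance `R` is within `η ≤ σ` of the slope of the soliton, itself at most `σ`
    -- in size; the slope at the vertex has the favourable sign.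
    have h1 := (abs_le.1 (hdist R hRmem).2).1
    have h2 := (abs_le.1 (abs_solitonDeriv_le hp R)).1
    simp only [sub_self]
    linarith
  have e5 : ∫ t in Ioi R, soliton p t ^ p ≤ σ / tailRate p :=
    (integral_Ioi_soliton_le hp hR0.le (by linarith)).trans
      (div_le_div_of_nonneg_right hR (tailRate_pos hp).le)
  have e6 : 0 ≤ ∫ t in R..ℓ, Z (ℓ - t) ^ p :=
    intervalIntegral.integral_nonneg hℓ fun t ht => Real.rpow_nonneg (hztail t ht).1.le _
  have e7 : 0 ≤ ∫ t in Ioi R, soliton p t ^ p :=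
    setIntegral_nonneg measurableSet_Ioi fun t _ => Real.rpow_nonneg (soliton_pos hp t).le _
  rw [e0, e1, e2]
  exact abs_add_sub_add_le e3 e6 e4 e7
    (e5.trans (div_le_div_of_nonneg_right (by linarith) (tailRate_pos hp).le))

/-- A bump of small boundary values is close to the soliton. -/
theorem exists_close_to_soliton {p ε b : ℝ} (hp : 2 < p) (hε : 0 < ε) (hb : 0 ≤ b) :
    ∃ δ₁ R : ℝ, 0 < δ₁ ∧ ∀ ℓ, R ≤ ℓ → ∀ Z W : ℝ → ℝ,
      IsNewtonSol (truncForce p (topLevel p)) Z W → 0 < Z 0 → Z 0 ≤ δ₁ → 0 < W 0 →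
      W 0 ≤ b * Z 0 → W ℓ = 0 → (∀ t ∈ Ico 0 ℓ, 0 < W t) →
      (∀ t ∈ Icc 0 ℓ, |Z t - soliton p (ℓ - t)| ≤ ε) ∧
      |(∫ t in (0 : ℝ)..ℓ, Z t ^ p) - ∫ t in Ioi 0, soliton p t ^ p| ≤ ε := by
  set K := topLevel p with hK
  have hK1 : 1 < K := one_lt_topLevel hp
  have hK0 : 0 < K := by linarith
  have hc := tailRate_pos hp
  set c := tailRate p with hcdef
  set Λ := p * K ^ (p - 1) with hΛ
  have hΛ0 : 0 < Λ := by positivity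
  obtain ⟨L, hL⟩ := exists_lipschitzWith_truncForce hp hK0.le
  -- The bound 1/4 keeps the tails `2 σ₀` below 1/2; the other two serve the uniform and the
  -- integral estimate.
  set σ₀ := min (1 / 4) (min (ε / 4) (ε * c / 8)) with hσ₀
  have hσ₀0 : 0 < σ₀ := by positivity
  have hσ1 : σ₀ ≤ 1 / 4 := min_le_left _ _
  have hσ2 : σ₀ ≤ ε / 4 := (min_le_right _ _).trans (min_le_left _ _)
  have hσ3 : σ₀ ≤ ε * c / 8 := (min_le_right _ _).trans (min_le_right _ _)
  obtain ⟨R, hR, hR1⟩ := (((tendsto_soliton_atTop hp).eventually (gt_mem_nhds hσ₀0)).and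
    (Filter.eventually_ge_atTop 1)).exists
  have hR0 : 0 < R := by linarith
  set η := min σ₀ (ε / (4 * Λ * R)) with hη
  have hη0 : 0 < η := by positivity
  have hησ : η ≤ σ₀ := min_le_left _ _
  have hη2 : R * (Λ * η) ≤ ε / 4 := by
    have := min_le_right σ₀ (ε / (4 * Λ * R))
    rw [← hη, le_div_iff₀ (by positivity)] at this
    linarith
  set X := Real.exp ((max 1 L : NNReal) * R) with hX
  have hX0 : 0 < X := Real.exp_pos _
  obtain ⟨ρ, hρ, hnear⟩ := exists_near_soliton_zero hp (div_pos hη0 hX0)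
  -- The first bound gives `Z 0 ≤ 1` and `W 0 ≤ 1`. The second makes the energy, of size at most `(1
  -- + b²) Z 0`, small enough for the peak to be within `η / X` of the soliton peak.
  refine ⟨min (1 / (1 + b)) (ρ / (1 + b ^ 2)), R, by positivity, ?_⟩
  intro ℓ hℓ Z W h hZ0 hZδ hW0 hWb hWℓ hpos
  have hℓ0 : 0 < ℓ := by linarith
  have hd1 : Z 0 * (1 + b) ≤ 1 := by
    have := hZδ.trans (min_le_left _ _)
    rwa [le_div_iff₀ (by positivity)] at this
  have hd2 : Z 0 * (1 + b ^ 2) ≤ ρ := by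
    have := hZδ.trans (min_le_right _ _)
    rwa [le_div_iff₀ (by positivity)] at this
  have hZ1 : Z 0 ≤ 1 := by nlinarith
  have hW1 : W 0 ≤ 1 := by nlinarith
  have hWnn : ∀ t ∈ Icc 0 ℓ, 0 ≤ W t := by
    intro t ht
    rcases ht.2.eq_or_lt with rfl | h1
    · exact hWℓ.ge
    · exact (hpos t ⟨ht.1, h1⟩).le
  have hrange := h.le_topLevel hp hWnn hZ0 hZ1 hW1
  have hmono := h.monotoneOn hWnn
  have hM1 := h.one_le_max hp hℓ0.le hWnn hW0 hWℓ
  have hen := h.energy_eq hp hℓ0.le fun t ht => ⟨hZ0.le.trans (hrange t ht).1, (hrange t ht).2⟩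
  rw [hWℓ] at hen
  have hME : |energyPot p (Z ℓ)| ≤ ρ := by
    have e1 := energyPot_le_sq hp hZ0.le
    have e2 := energyPot_nonneg hp hZ0 hZ1
    have e3 : W 0 ^ 2 ≤ b ^ 2 * Z 0 ^ 2 := by
      rw [← mul_pow]; exact pow_le_pow_left₀ hW0.le hWb 2
    have e4 : Z 0 ^ 2 ≤ Z 0 := by nlinarith
    have e5 : b ^ 2 * Z 0 ^ 2 ≤ b ^ 2 * Z 0 := mul_le_mul_of_nonneg_left e4 (sq_nonneg b)
    rw [abs_le]
    constructor <;> nlinarith [sq_nonneg (W 0), sq_nonneg b]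
  have hM := hnear _ hM1 hME
  have hz := h.comp_sub_left ℓ
  -- Time is reversed to start at the peak, where both slopes vanish; Grönwall over length `R` costs
  -- the factor `X`.
  have hdist : ∀ t ∈ Icc 0 R, |Z (ℓ - t) - soliton p t| ≤ η ∧
      |-W (ℓ - t) - solitonDeriv p t| ≤ η := by
    intro t ht
    have e := IsNewtonSol.dist_le hL hz (isNewtonSol_soliton hp) ht.1
    simp only [Prod.dist_eq, Real.dist_eq, sub_zero, hWℓ, solitonDeriv_zero, neg_zero, abs_zero] at e
    rw [max_eq_left (abs_nonneg (Z ℓ - soliton p 0))] at e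
    have e2 : Real.exp ((max 1 L : NNReal) * t) ≤ X :=
      Real.exp_le_exp.2 (mul_le_mul_of_nonneg_left ht.2 (by positivity))
    have e3 := mul_le_mul hM e2 (Real.exp_pos _).le (by positivity)
    rw [div_mul_cancel₀ _ hX0.ne'] at e3
    have e4 := e.trans e3
    exact ⟨(le_max_left _ _).trans e4, (le_max_right _ _).trans e4⟩
  have hRmem : R ∈ Icc 0 R := ⟨hR0.le, le_rfl⟩
  have hzR : Z (ℓ - R) ≤ σ₀ + σ₀ := by
    have := (abs_le.1 (hdist R hRmem).1).2
    linarith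
  have hzmem : ∀ t ∈ Icc 0 ℓ, ℓ - t ∈ Icc 0 ℓ := fun t ht => ⟨by linarith [ht.2], by linarith [ht.1]⟩
  have hztail : ∀ t ∈ Icc R ℓ, 0 < Z (ℓ - t) ∧ Z (ℓ - t) ≤ σ₀ + σ₀ := by
    intro t ht
    have h1 := hzmem t ⟨by linarith [ht.1], ht.2⟩
    exact ⟨hZ0.trans_le (hrange _ h1).1,
      (hmono h1 (hzmem R ⟨hR0.le, hℓ⟩) (by linarith [ht.1])).trans hzR⟩
  have hφtail : ∀ t, R ≤ t → soliton p t ≤ σ₀ := fun t ht =>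
    ((strictAntiOn_soliton hp).antitoneOn hR0.le (hR0.le.trans ht) ht).trans hR.le
  constructor
  · intro t ht
    have key : ∀ s ∈ Icc 0 ℓ, |Z (ℓ - s) - soliton p s| ≤ ε := by
      intro s hs
      rcases le_total s R with h1 | h1
      · exact (hdist s ⟨hs.1, h1⟩).1.trans (by linarith)
      · have e1 := hztail s ⟨h1, hs.2⟩
        have e2 := hφtail s h1
        have e3 := soliton_pos hp s
        rw [abs_le]
        constructor <;> linarith [e1.1, e1.2]
    have := key _ (hzmem t ht)
    rwa [sub_sub_cancel] at this
  · have e := h.abs_integral_sub_soliton_le hp hR0 hℓ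
      (fun t ht => ⟨hZ0.trans_le (hrange t ht).1, (hrange t ht).2⟩) hW0.le hdist hztail hR.le hσ1 hησ
    have e8 : (σ₀ + σ₀) / c ≤ ε / 4 := by
      rw [div_le_iff₀ hc]; linarith
    exact e.trans (by linarith)

/-! ### Classical solutions on an edge: weak form and action -/

/-- `f` is twice differentiable with derivative `f'` and solves `-f'' + f = |f|^(p-2) f` on `I`. -/
structure IsEdgeSol (p : ℝ) (I : Set ℝ) (f f' : ℝ → ℝ) : Prop where
  deriv_fst : ∀ x, HasDerivAt f (f' x) x
  deriv_snd : ∃ g : ℝ → ℝ, Continuous g ∧ (∀ x, HasDerivAt f' (g x) x) ∧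
    ∀ x ∈ I, g x = f x - |f x| ^ (p - 2) * f x

theorem IsNewtonSol.isEdgeSol {p κ : ℝ} {y w : ℝ → ℝ} {I : Set ℝ} (hp : 2 < p) (hκ : 0 ≤ κ)
    (h : IsNewtonSol (truncForce p κ) y w) (hy : ∀ x ∈ I, 0 < y x ∧ y x ≤ κ) :
    IsEdgeSol p I y w where
  deriv_fst := h.deriv_fst
  deriv_snd := ⟨fun x => truncForce p κ (y x),
    (continuous_truncForce hp hκ).comp h.continuous_fst, h.deriv_snd, fun x hx => by
      change truncForce p κ (y x) = _
      rw [truncForce_of_mem (hy x hx).1.le (hy x hx).2, rpow_sub_one_eq_mul (hy x hx).1,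
        abs_of_pos (hy x hx).1, mul_comm]⟩

theorem IsNewtonSol.comp_const_add {F y w : ℝ → ℝ} (h : IsNewtonSol F y w) (a : ℝ) :
    IsNewtonSol F (fun x => y (a + x)) (fun x => w (a + x)) where
  deriv_fst x := (h.deriv_fst (a + x)).comp_const_add a x
  deriv_snd x := (h.deriv_snd (a + x)).comp_const_add a x

theorem volume_Icc_sdiff_interior (a b : ℝ) : volume (Icc a b \ interior (Icc a b)) = 0 := by
  rw [interior_Icc]
  refine measure_mono_null (t := {a, b}) (fun x hx => ?_) ((Set.toFinite _).measure_zero _)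
  by_contra hn
  simp only [mem_insert_iff, mem_singleton_iff, not_or] at hn
  exact hx.2 ⟨hx.1.1.lt_of_ne (Ne.symm hn.1), hx.1.2.lt_of_ne hn.2⟩

theorem volume_Ici_sdiff_interior (a : ℝ) : volume (Ici a \ interior (Ici a)) = 0 := by
  rw [interior_Ici, Ici_sdiff_Ioi_same]
  exact measure_singleton a

theorem memLp_two_Icc {f : ℝ → ℝ} (hf : Continuous f) (a b : ℝ) :
    MemLp f 2 (volume.restrict (Icc a b)) := by
  rw [memLp_two_iff_integrable_sq hf.aestronglyMeasurable]
  exact (hf.pow 2).integrableOn_Icc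

namespace IsEdgeSol

variable {p : ℝ} {I : Set ℝ} {f f' : ℝ → ℝ}

theorem mono (h : IsEdgeSol p I f f') {J : Set ℝ} (hJ : J ⊆ I) : IsEdgeSol p J f f' where
  deriv_fst := h.deriv_fst
  deriv_snd := by
    obtain ⟨g, hg, hg', hgI⟩ := h.deriv_snd
    exact ⟨g, hg, hg', fun x hx => hgI x (hJ hx)⟩

theorem continuous_fst (h : IsEdgeSol p I f f') : Continuous f :=
  continuous_iff_continuousAt.2 fun x => (h.deriv_fst x).continuousAt

theorem continuous_snd (h : IsEdgeSol p I f f') : Continuous f' := by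
  obtain ⟨g, hg, hg', hgI⟩ := h.deriv_snd
  exact continuous_iff_continuousAt.2 fun x => (hg' x).continuousAt

theorem memH1Interval (h : IsEdgeSol p I f f') (h1 : MemLp f 2 (volume.restrict I))
    (h2 : MemLp f' 2 (volume.restrict I)) : MemH1Interval I f :=
  ⟨h1, f', h2, isWeakDeriv_of_hasDerivAt h.deriv_fst h.continuous_snd⟩

theorem memH1Interval_Icc {a b : ℝ} (h : IsEdgeSol p (Icc a b) f f') :
    MemH1Interval (Icc a b) f :=
  h.memH1Interval (memLp_two_Icc h.continuous_fst a b) (memLp_two_Icc h.continuous_snd a b)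

/-- The weak form of the equation on a compact edge. -/
theorem integral_Icc_eq {b : ℝ} (hb : 0 < b) (h : IsEdgeSol p (Icc 0 b) f f') {η : ℝ → ℝ}
    (hη : ContinuousOn η (Icc 0 b)) (hη1 : MemH1Interval (Icc 0 b) η) :
    ∫ x in Icc 0 b, (weakDeriv (Icc 0 b) f x * weakDeriv (Icc 0 b) η x + f x * η x
      - |f x| ^ (p - 2) * f x * η x) = f' b * η b - f' 0 * η 0 := by
  obtain ⟨g, hg, hg', hgI⟩ := h.deriv_snd
  -- The parts formula is used with `f'` as the smooth factor: on the edge $f''\eta$ equals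
  -- $(f-|f|^{p-2}f)\eta$.
  rw [← hη1.integral_mul_weakDeriv_add hη hb Subset.rfl hg' hg, intervalIntegral.integral_of_le hb.le,
    ← integral_Icc_eq_integral_Ioc]
  refine integral_congr_ae ?_
  filter_upwards [weakDeriv_ae_eq (volume_Icc_sdiff_interior 0 b) h.deriv_fst h.continuous_snd
    (memLp_two_Icc h.continuous_snd 0 b), ae_restrict_mem measurableSet_Icc] with x hx hxI
  rw [hx, hgI x hxI]; ring

/-- The weak form of the equation on a half-line. -/
theorem integral_Ici_eq (h : IsEdgeSol p (Ici 0) f f') (h1 : MemLp f 2 (volume.restrict (Ici 0)))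
    (h2 : MemLp f' 2 (volume.restrict (Ici 0))) (hf'' : MemLp (fun x => |f x| ^ (p - 2) * f x) 2
      (volume.restrict (Ici 0))) {η : ℝ → ℝ}
    (hη : ContinuousOn η (Ici 0)) (hη1 : MemH1Interval (Ici 0) η) :
    ∫ x in Ici 0, (weakDeriv (Ici 0) f x * weakDeriv (Ici 0) η x + f x * η x
      - |f x| ^ (p - 2) * f x * η x) = - (f' 0 * η 0) := by
  obtain ⟨g, hg, hg', hgI⟩ := h.deriv_snd
  have hg2 : MemLp g 2 (volume.restrict (Ici 0)) := by
    refine (h1.sub hf'').ae_eq ?_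
    filter_upwards [ae_restrict_mem measurableSet_Ici] with x hx
    rw [hgI x hx]; rfl
  rw [← hη1.integral_Ici_mul_weakDeriv_add hη hg' hg h2 hg2]
  refine integral_congr_ae ?_
  filter_upwards [weakDeriv_ae_eq (volume_Ici_sdiff_interior 0) h.deriv_fst h.continuous_snd
    h2, ae_restrict_mem measurableSet_Ici] with x hx hxI
  rw [hx, hgI x hxI]; ring

end IsEdgeSol

theorem abs_rpow_mul_self_mul_self {p : ℝ} (hp : 2 < p) (u : ℝ) :
    |u| ^ (p - 2) * u * u = |u| ^ p := by
  rcases eq_or_ne u 0 with rfl | hu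
  · rw [mul_zero, abs_zero, Real.zero_rpow (by linarith)]
  · rw [rpow_eq_sq_mul (p := p) (abs_pos.2 hu), sq_abs]; ring

/-- The action in terms of the Nehari functional and the `L^p` norm. -/
theorem intervalAction_eq {p : ℝ} (hp : 2 < p) {I : Set ℝ} {u : ℝ → ℝ} (hu : MemH1Interval I u)
    (hi : IntegrableOn (fun x => |u x| ^ p) I) :
    intervalAction p I u = 1 / 2 * (∫ x in I, (weakDeriv I u x * weakDeriv I u x + u x * u x
      - |u x| ^ (p - 2) * u x * u x)) + (1 / 2 - 1 / p) * ∫ x in I, |u x| ^ p := by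
  have h1 : IntegrableOn (fun x => weakDeriv I u x ^ 2 + u x ^ 2) I :=
    (weakDeriv_spec hu).1.integrable_sq.add hu.1.integrable_sq
  have e : ∀ x, weakDeriv I u x * weakDeriv I u x + u x * u x - |u x| ^ (p - 2) * u x * u x
      = weakDeriv I u x ^ 2 + u x ^ 2 - |u x| ^ p := fun x => by
    rw [abs_rpow_mul_self_mul_self hp]; ring
  simp_rw [e]
  rw [integral_sub h1 hi, intervalAction]
  ring

theorem integral_soliton_rpow_eq {p : ℝ} :
    ∫ x, soliton p x ^ p = 2 * ∫ x in Ioi 0, soliton p x ^ p := by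
  rw [← integral_comp_abs (f := fun x => soliton p x ^ p)]
  congr 1
  funext x
  rcases abs_choice x with h | h <;> rw [h]
  rw [soliton_neg]

theorem memLp_soliton_force {p : ℝ} (hp : 2 < p) (a : ℝ) :
    MemLp (fun x => |soliton p (a + x)| ^ (p - 2) * soliton p (a + x)) 2 := by
  have h := (memLp_soliton_comp_add hp a).1
  have hc : Continuous fun x => soliton p (a + x) :=
    (continuous_soliton hp).comp (continuous_const.add continuous_id)
  refine (h.const_mul (soliton p 0 ^ (p - 2))).mono'
    (((hc.abs.rpow_const fun _ => Or.inr (by linarith)).mul hc).aestronglyMeasurable)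
    (Filter.Eventually.of_forall fun x => ?_)
  have hs := soliton_pos hp (a + x)
  rw [Real.norm_eq_abs, abs_of_pos hs, abs_of_pos (by positivity)]
  exact mul_le_mul_of_nonneg_right
    (Real.rpow_le_rpow hs.le (soliton_le_zero hp _) (by linarith)) hs.le

/-- The Nehari functional of the soliton vanishes, being the integral over the line of the
derivative of $\varphi\varphi'$. -/
theorem intervalAction_soliton {p : ℝ} (hp : 2 < p) :
    intervalAction p univ (soliton p)
      = (1 / 2 - 1 / p) * (2 * ∫ x in Ioi 0, soliton p x ^ p) := by
  have hm := memLp_soliton_comp_add hp 0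
  have hmf := memLp_soliton_force hp 0
  simp only [zero_add] at hm hmf
  have hmu : MemLp (soliton p) 2 (volume.restrict univ) := by rw [Measure.restrict_univ]; exact hm.1
  have hmu' : MemLp (solitonDeriv p) 2 (volume.restrict univ) := by
    rw [Measure.restrict_univ]; exact hm.2
  have hH : MemH1Interval univ (soliton p) :=
    ⟨hmu, _, hmu', isWeakDeriv_of_hasDerivAt (hasDerivAt_soliton hp) (continuous_solitonDeriv hp)⟩
  have habs : ∀ x, |soliton p x| = soliton p x := fun x => abs_of_pos (soliton_pos hp x)
  rw [intervalAction_eq hp hH (by simp only [habs]; exact (integrable_soliton_rpow hp).integrableOn)]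
  have hae := weakDeriv_ae_eq (I := univ) (by simp) (hasDerivAt_soliton hp)
    (continuous_solitonDeriv hp) hmu'
  rw [Measure.restrict_univ] at hae
  have e0 : ∫ x, (weakDeriv univ (soliton p) x * weakDeriv univ (soliton p) x
      + soliton p x * soliton p x - |soliton p x| ^ (p - 2) * soliton p x * soliton p x) = 0 := by
    rw [← integral_eq_zero_of_hasDerivAt_of_integrable
      (f := fun x => soliton p x * solitonDeriv p x)
      (f' := fun x => solitonDeriv p x * solitonDeriv p x
        + soliton p x * (soliton p x - soliton p x ^ (p - 1)))
      (fun x => (hasDerivAt_soliton hp x).mul (hasDerivAt_solitonDeriv hp x)) ?_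
      (hm.1.integrable_mul hm.2)]
    · refine integral_congr_ae ?_
      filter_upwards [hae] with x hx
      rw [hx, rpow_sub_one_eq_mul (soliton_pos hp x), habs]; ring
    · refine (hm.2.integrable_mul hm.2).add ?_
      have : (fun x => soliton p x * (soliton p x - soliton p x ^ (p - 1)))
          = fun x => soliton p x * (soliton p x - |soliton p x| ^ (p - 2) * soliton p x) := by
        funext x
        rw [rpow_sub_one_eq_mul (soliton_pos hp x), habs]; ring
      rw [this]
      exact hm.1.integrable_mul (hm.1.sub hmf)
  rw [Measure.restrict_univ, e0, mul_zero, zero_add]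
  simp only [habs]
  rw [integral_soliton_rpow_eq]

/-! ### Gluing the profiles on the graph -/

theorem sum_knotEdge {H P L : ℕ} (f : KnotEdge H P L → ℝ) :
    ∑ e, f e = ∑ h, f (.halfLine h) + (∑ i, f (.pendant i) + ∑ i, f (.loop i)) := by
  let φ : Fin H ⊕ (Fin P ⊕ Fin L) ≃ KnotEdge H P L :=
    { toFun := fun s => match s with
        | .inl h => .halfLine h
        | .inr (.inl i) => .pendant i
        | .inr (.inr i) => .loop i
      invFun := fun e => match e with
        | .halfLine h => .inl h
        | .pendant i => .inr (.inl i)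
        | .loop i => .inr (.inr i)
      left_inv := by rintro (_ | _ | _) <;> rfl
      right_inv := by rintro (_ | _ | _) <;> rfl }
  rw [← φ.sum_comp, Fintype.sum_sum_type, Fintype.sum_sum_type]
  rfl

theorem sum_ite_mem_fin {n : ℕ} (A : Finset (Fin n)) (a b : ℝ) :
    ∑ i, (if i ∈ A then a else b) = A.card * a + (n - A.card) * b := by
  have : ∀ i, (if i ∈ A then a else b) = b + if i ∈ A then a - b else 0 := fun i => by
    split_ifs <;> ring
  simp_rw [this]
  rw [Finset.sum_add_distrib, Finset.sum_ite_mem, Finset.univ_inter]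
  simp
  ring

/-- A positive solution on `[0, 2ℓ]`, symmetric about `ℓ`, with the value `δ` at the ends. -/
structure IsCoreProfile (p ℓ δ : ℝ) (f f' : ℝ → ℝ) : Prop where
  sol : IsEdgeSol p (Icc 0 (2 * ℓ)) f f'
  symm : ∀ x, f (2 * ℓ - x) = f x
  symm_deriv : ∀ x, f' (2 * ℓ - x) = -f' x
  zero : f 0 = δ
  pos : ∀ x ∈ Icc 0 (2 * ℓ), 0 < f x

/-- Uniqueness makes a solution with zero slope at `ℓ` even about `ℓ`, so bounds on `[0, ℓ]` extend
to a whole loop. -/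
theorem IsNewtonSol.isCoreProfile {p κ ℓ : ℝ} (hp : 2 < p) (hκ : 0 ≤ κ) {y w : ℝ → ℝ}
    (h : IsNewtonSol (truncForce p κ) y w) (hw : w ℓ = 0)
    (hy : ∀ t ∈ Icc 0 ℓ, 0 < y t ∧ y t ≤ κ) : IsCoreProfile p ℓ (y 0) y w := by
  obtain ⟨K, hK⟩ := exists_lipschitzWith_truncForce hp hκ
  have hs := h.symm_of_eq_zero hK hw
  have hy2 : ∀ t ∈ Icc 0 (2 * ℓ), 0 < y t ∧ y t ≤ κ := by
    intro t ht
    rcases le_total t ℓ with h1 | h1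
    · exact hy t ⟨ht.1, h1⟩
    · rw [← (hs t).1]
      exact hy _ ⟨by linarith [ht.2], by linarith⟩
  exact ⟨h.isEdgeSol hp hκ hy2, fun x => (hs x).1, fun x => (hs x).2, rfl, fun x hx => (hy2 x hx).1⟩

namespace IsCoreProfile

variable {p ℓ δ : ℝ} {f f' : ℝ → ℝ}

theorem end_eq (h : IsCoreProfile p ℓ δ f f') : f (2 * ℓ) = δ := by
  rw [← h.zero, ← h.symm 0, sub_zero]

theorem deriv_end (h : IsCoreProfile p ℓ δ f f') : f' (2 * ℓ) = -f' 0 := by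
  rw [← h.symm_deriv 0, sub_zero]

theorem deriv_mid (h : IsCoreProfile p ℓ δ f f') : f' ℓ = 0 := by
  have := h.symm_deriv ℓ
  rw [two_mul, add_sub_cancel_right] at this
  linarith

theorem sol_half (h : IsCoreProfile p ℓ δ f f') (hℓ : 0 < ℓ) : IsEdgeSol p (Icc 0 ℓ) f f' :=
  h.sol.mono (Icc_subset_Icc_right (by linarith))

theorem continuous_abs_rpow (h : IsCoreProfile p ℓ δ f f') (hp : 2 < p) :
    Continuous fun x => |f x| ^ p :=
  h.sol.continuous_fst.abs.rpow_const fun _ => Or.inr (by linarith)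

theorem integral_pendant (h : IsCoreProfile p ℓ δ f f') (hℓ : 0 < ℓ) :
    ∫ x in Icc 0 ℓ, |f x| ^ p = ∫ x in (0 : ℝ)..ℓ, f x ^ p := by
  rw [integral_Icc_eq_integral_Ioc, intervalIntegral.integral_of_le hℓ.le]
  refine setIntegral_congr_fun measurableSet_Ioc fun x hx => ?_
  simp only [abs_of_pos (h.pos x ⟨hx.1.le, by linarith [hx.2]⟩)]

theorem integral_loop (h : IsCoreProfile p ℓ δ f f') (hp : 2 < p) (hℓ : 0 < ℓ) :
    ∫ x in Icc 0 (2 * ℓ), |f x| ^ p = 2 * ∫ x in (0 : ℝ)..ℓ, f x ^ p := by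
  have hc := h.continuous_abs_rpow hp
  have e : ∫ x in ℓ..2 * ℓ, |f x| ^ p = ∫ x in (0 : ℝ)..ℓ, |f x| ^ p := by
    have := intervalIntegral.integral_comp_sub_left (a := 0) (b := ℓ) (fun x => |f x| ^ p) (2 * ℓ)
    rw [sub_zero, show 2 * ℓ - ℓ = ℓ by ring] at this
    rw [← this]
    simp only [h.symm]
  have e2 : ∫ x in (0 : ℝ)..ℓ, |f x| ^ p = ∫ x in (0 : ℝ)..ℓ, f x ^ p := by
    rw [← h.integral_pendant hℓ, integral_Icc_eq_integral_Ioc, intervalIntegral.integral_of_le hℓ.le]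
  rw [integral_Icc_eq_integral_Ioc, ← intervalIntegral.integral_of_le (by linarith),
    ← intervalIntegral.integral_add_adjacent_intervals (hc.intervalIntegrable 0 ℓ)
      (hc.intervalIntegrable ℓ (2 * ℓ)), e, e2]
  ring

end IsCoreProfile

/-- The edge functions of a function that is a shifted soliton on the half-lines, has the profile
`f₁` on the pendants in `A` and the loops in `B`, and the profile `f₂` on the others. -/
def knotEdgeFun {H P L : ℕ} (A : Finset (Fin P)) (B : Finset (Fin L)) (p a : ℝ) (f₁ f₂ : ℝ → ℝ) :
    KnotEdge H P L → ℝ → ℝ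
  | .halfLine _ => fun x => soliton p (a + x)
  | .pendant i => if i ∈ A then f₁ else f₂
  | .loop i => if i ∈ B then f₁ else f₂

/-- The function on the graph with the edge functions `knotEdgeFun`. -/
def knotFunc {H P L : ℕ} (A : Finset (Fin P)) (B : Finset (Fin L)) {p a ℓ δ : ℝ}
    {f₁ f₁' f₂ f₂' : ℝ → ℝ} {G : SingleKnotGraph H P L} (hG : G.IsRegular ℓ)
    (ha : soliton p a = δ) (h₁ : IsCoreProfile p ℓ δ f₁ f₁') (h₂ : IsCoreProfile p ℓ δ f₂ f₂') :
    G.Func where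
  vertex := δ
  edge := knotEdgeFun A B p a f₁ f₂
  edge_zero := by
    rintro (i | i | i)
    · simpa [knotEdgeFun] using ha
    · simp only [knotEdgeFun]; split_ifs
      exacts [h₁.zero, h₂.zero]
    · simp only [knotEdgeFun]; split_ifs
      exacts [h₁.zero, h₂.zero]
  loop_end i := by
    simp only [knotEdgeFun, hG.2 i]; split_ifs
    exacts [h₁.end_eq, h₂.end_eq]

section

variable {H P L : ℕ} {A : Finset (Fin P)} {B : Finset (Fin L)} {p a ℓ δ : ℝ}
  {f₁ f₁' f₂ f₂' : ℝ → ℝ} {G : SingleKnotGraph H P L}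

theorem isEdgeSol_soliton (hp : 2 < p) (a : ℝ) : IsEdgeSol p (Ici 0)
    (fun x => soliton p (a + x)) (fun x => solitonDeriv p (a + x)) :=
  ((isNewtonSol_soliton hp).comp_const_add a).isEdgeSol hp (by linarith [one_lt_topLevel hp])
    fun x _ => ⟨soliton_pos hp _, soliton_le_topLevel hp _⟩

theorem continuous_knotEdgeFun (hp : 2 < p) (h₁ : IsCoreProfile p ℓ δ f₁ f₁')
    (h₂ : IsCoreProfile p ℓ δ f₂ f₂') (e : KnotEdge H P L) :
    Continuous (knotEdgeFun A B p a f₁ f₂ e) := by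
  rcases e with i | i | i
  · exact (isEdgeSol_soliton hp a).continuous_fst
  · simp only [knotEdgeFun]; split_ifs
    exacts [h₁.sol.continuous_fst, h₂.sol.continuous_fst]
  · simp only [knotEdgeFun]; split_ifs
    exacts [h₁.sol.continuous_fst, h₂.sol.continuous_fst]

theorem knotFunc_memH1 (hp : 2 < p) (hℓ : 0 < ℓ) (hG : G.IsRegular ℓ) (ha : soliton p a = δ)
    (h₁ : IsCoreProfile p ℓ δ f₁ f₁') (h₂ : IsCoreProfile p ℓ δ f₂ f₂') :
    (knotFunc A B hG ha h₁ h₂).MemH1 := by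
  intro e
  refine ⟨(continuous_knotEdgeFun hp h₁ h₂ e).continuousOn, ?_⟩
  rcases e with i | i | i
  · have h := memLp_soliton_comp_add hp a
    exact (isEdgeSol_soliton hp a).memH1Interval (h.1.restrict _) (h.2.restrict _)
  · simp only [SingleKnotGraph.dom, knotFunc, knotEdgeFun, hG.1 i]; split_ifs
    exacts [(h₁.sol_half hℓ).memH1Interval_Icc, (h₂.sol_half hℓ).memH1Interval_Icc]
  · simp only [SingleKnotGraph.dom, knotFunc, knotEdgeFun, hG.2 i]; split_ifs
    exacts [h₁.sol.memH1Interval_Icc, h₂.sol.memH1Interval_Icc]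

/-- The weak form of the equation reduces to the flux at the vertex. -/
theorem knotFunc_weak_form (hp : 2 < p) (hℓ : 0 < ℓ) (hG : G.IsRegular ℓ) (ha : soliton p a = δ)
    (h₁ : IsCoreProfile p ℓ δ f₁ f₁') (h₂ : IsCoreProfile p ℓ δ f₂ f₂')
    (hflux : H * solitonDeriv p a + (A.card + 2 * B.card : ℕ) * f₁' 0
      + ((P - A.card) + 2 * (L - B.card)) * f₂' 0 = 0) {η : G.Func} (hη : η.MemH1) :
    ∑ e, ∫ x in G.dom e,
        (weakDeriv (G.dom e) ((knotFunc A B hG ha h₁ h₂).edge e) x * weakDeriv (G.dom e) (η.edge e) x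
          + (knotFunc A B hG ha h₁ h₂).edge e x * η.edge e x
          - |(knotFunc A B hG ha h₁ h₂).edge e x| ^ (p - 2)
            * (knotFunc A B hG ha h₁ h₂).edge e x * η.edge e x) = 0 := by
  rw [sum_knotEdge]
  have e1 : ∀ i : Fin H, ∫ x in G.dom (.halfLine i),
        (weakDeriv (G.dom (.halfLine i)) ((knotFunc A B hG ha h₁ h₂).edge (.halfLine i)) x
            * weakDeriv (G.dom (.halfLine i)) (η.edge (.halfLine i)) x
          + (knotFunc A B hG ha h₁ h₂).edge (.halfLine i) x * η.edge (.halfLine i) x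
          - |(knotFunc A B hG ha h₁ h₂).edge (.halfLine i) x| ^ (p - 2)
            * (knotFunc A B hG ha h₁ h₂).edge (.halfLine i) x * η.edge (.halfLine i) x)
      = -(solitonDeriv p a * η.vertex) := by
    intro i
    have h := memLp_soliton_comp_add hp a
    have := (isEdgeSol_soliton hp a).integral_Ici_eq (h.1.restrict _) (h.2.restrict _)
      ((memLp_soliton_force hp a).restrict _) (hη (.halfLine i)).1 (hη (.halfLine i)).2
    rw [η.edge_zero, add_zero] at this
    exact this
  -- The slope vanishes at the tip of a pendant, so only the vertex contributes, whatever the test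
  -- function does at the tip.
  have e2 : ∀ i : Fin P, ∫ x in G.dom (.pendant i),
        (weakDeriv (G.dom (.pendant i)) ((knotFunc A B hG ha h₁ h₂).edge (.pendant i)) x
            * weakDeriv (G.dom (.pendant i)) (η.edge (.pendant i)) x
          + (knotFunc A B hG ha h₁ h₂).edge (.pendant i) x * η.edge (.pendant i) x
          - |(knotFunc A B hG ha h₁ h₂).edge (.pendant i) x| ^ (p - 2)
            * (knotFunc A B hG ha h₁ h₂).edge (.pendant i) x * η.edge (.pendant i) x)
      = if i ∈ A then -(f₁' 0 * η.vertex) else -(f₂' 0 * η.vertex) := by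
    intro i
    have hηi := hη (.pendant i)
    simp only [SingleKnotGraph.dom, knotFunc, knotEdgeFun, hG.1 i] at hηi ⊢
    split_ifs
    · rw [(h₁.sol_half hℓ).integral_Icc_eq hℓ hηi.1 hηi.2, h₁.deriv_mid, η.edge_zero]; ring
    · rw [(h₂.sol_half hℓ).integral_Icc_eq hℓ hηi.1 hηi.2, h₂.deriv_mid, η.edge_zero]; ring
  -- Both ends of a loop are the vertex and carry opposite slopes, so a loop counts as two compact
  -- edges.
  have e3 : ∀ i : Fin L, ∫ x in G.dom (.loop i),
        (weakDeriv (G.dom (.loop i)) ((knotFunc A B hG ha h₁ h₂).edge (.loop i)) x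
            * weakDeriv (G.dom (.loop i)) (η.edge (.loop i)) x
          + (knotFunc A B hG ha h₁ h₂).edge (.loop i) x * η.edge (.loop i) x
          - |(knotFunc A B hG ha h₁ h₂).edge (.loop i) x| ^ (p - 2)
            * (knotFunc A B hG ha h₁ h₂).edge (.loop i) x * η.edge (.loop i) x)
      = if i ∈ B then -(2 * f₁' 0 * η.vertex) else -(2 * f₂' 0 * η.vertex) := by
    intro i
    have hηi := hη (.loop i)
    have hηe := η.loop_end i
    have hℓ2 : 0 < 2 * ℓ := by linarith
    rw [hG.2 i] at hηe
    simp only [SingleKnotGraph.dom, knotFunc, knotEdgeFun, hG.2 i] at hηi ⊢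
    split_ifs
    · rw [h₁.sol.integral_Icc_eq hℓ2 hηi.1 hηi.2, h₁.deriv_end, η.edge_zero, hηe]; ring
    · rw [h₂.sol.integral_Icc_eq hℓ2 hηi.1 hηi.2, h₂.deriv_end, η.edge_zero, hηe]; ring
  rw [Finset.sum_congr rfl fun i _ => e1 i, Finset.sum_congr rfl fun i _ => e2 i,
    Finset.sum_congr rfl fun i _ => e3 i, sum_ite_mem_fin, sum_ite_mem_fin, Finset.sum_const,
    Finset.card_univ, Fintype.card_fin, nsmul_eq_mul]
  push_cast at hflux
  linear_combination (-η.vertex) * hflux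

theorem integrableOn_soliton_comp_add (hp : 2 < p) (a : ℝ) :
    IntegrableOn (fun x => |soliton p (a + x)| ^ p) (Ici 0) := by
  simp only [abs_of_pos (soliton_pos hp _)]
  exact ((integrable_soliton_rpow hp).comp_add_left a).integrableOn

theorem integral_soliton_comp_add (hp : 2 < p) (a : ℝ) :
    ∫ x in Ici 0, |soliton p (a + x)| ^ p = ∫ x in Ioi a, soliton p x ^ p := by
  simp only [abs_of_pos (soliton_pos hp _)]
  rw [integral_Ici_eq_integral_Ioi]
  have := (measurePreserving_add_left volume a).setIntegral_preimage_emb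
    (measurableEmbedding_addLeft a) (fun x => soliton p x ^ p) (Ioi a)
  rwa [preimage_const_add_Ioi, sub_self] at this

/-- Testing the equation with the function itself removes the quadratic part of the action, and only
the $L^p$ integrals remain. -/
theorem knotFunc_action (hp : 2 < p) (hℓ : 0 < ℓ) (hG : G.IsRegular ℓ) (ha : soliton p a = δ)
    (h₁ : IsCoreProfile p ℓ δ f₁ f₁') (h₂ : IsCoreProfile p ℓ δ f₂ f₂')
    (hflux : H * solitonDeriv p a + (A.card + 2 * B.card : ℕ) * f₁' 0
      + ((P - A.card) + 2 * (L - B.card)) * f₂' 0 = 0) :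
    (knotFunc A B hG ha h₁ h₂).action p = (1 / 2 - 1 / p) *
      (H * (∫ x in Ioi a, soliton p x ^ p)
        + (A.card + 2 * B.card : ℕ) * (∫ x in (0 : ℝ)..ℓ, f₁ x ^ p)
        + ((P - A.card) + 2 * (L - B.card)) * ∫ x in (0 : ℝ)..ℓ, f₂ x ^ p) := by
  have hm := knotFunc_memH1 (A := A) (B := B) hp hℓ hG ha h₁ h₂
  have hi : ∀ e, IntegrableOn (fun x => |(knotFunc A B hG ha h₁ h₂).edge e x| ^ p) (G.dom e) := by
    intro e
    have hc : Continuous fun x => |(knotFunc A B hG ha h₁ h₂).edge e x| ^ p :=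
      (continuous_knotEdgeFun hp h₁ h₂ e).abs.rpow_const fun _ => Or.inr (by linarith)
    rcases e with i | i | i
    · exact integrableOn_soliton_comp_add hp a
    · exact hc.integrableOn_Icc
    · exact hc.integrableOn_Icc
  rw [SingleKnotGraph.Func.action, Finset.sum_congr rfl fun e _ =>
      intervalAction_eq hp (hm e).2 (hi e), Finset.sum_add_distrib,
    ← Finset.mul_sum, knotFunc_weak_form hp hℓ hG ha h₁ h₂ hflux hm, mul_zero, zero_add,
    ← Finset.mul_sum, sum_knotEdge]
  have e1 : ∀ i : Fin H, ∫ x in G.dom (.halfLine i),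
      |(knotFunc A B hG ha h₁ h₂).edge (.halfLine i) x| ^ p = ∫ x in Ioi a, soliton p x ^ p :=
    fun i => integral_soliton_comp_add hp a
  have e2 : ∀ i : Fin P, ∫ x in G.dom (.pendant i),
      |(knotFunc A B hG ha h₁ h₂).edge (.pendant i) x| ^ p
      = if i ∈ A then ∫ x in (0 : ℝ)..ℓ, f₁ x ^ p else ∫ x in (0 : ℝ)..ℓ, f₂ x ^ p := by
    intro i
    simp only [SingleKnotGraph.dom, knotFunc, knotEdgeFun, hG.1 i]
    split_ifs
    exacts [h₁.integral_pendant hℓ, h₂.integral_pendant hℓ]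
  have e3 : ∀ i : Fin L, ∫ x in G.dom (.loop i),
      |(knotFunc A B hG ha h₁ h₂).edge (.loop i) x| ^ p
      = if i ∈ B then 2 * ∫ x in (0 : ℝ)..ℓ, f₁ x ^ p else 2 * ∫ x in (0 : ℝ)..ℓ, f₂ x ^ p := by
    intro i
    simp only [SingleKnotGraph.dom, knotFunc, knotEdgeFun, hG.2 i]
    split_ifs
    exacts [h₁.integral_loop hp hℓ, h₂.integral_loop hp hℓ]
  rw [Finset.sum_congr rfl fun i _ => e1 i, Finset.sum_congr rfl fun i _ => e2 i,
    Finset.sum_congr rfl fun i _ => e3 i, sum_ite_mem_fin, sum_ite_mem_fin, Finset.sum_const,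
    Finset.card_univ, Fintype.card_fin, nsmul_eq_mul]
  push_cast
  ring

theorem knotFunc_core_of_mem (hG : G.IsRegular ℓ) (ha : soliton p a = δ)
    (h₁ : IsCoreProfile p ℓ δ f₁ f₁') (h₂ : IsCoreProfile p ℓ δ f₂ f₂') {κ : CoreEdge P L}
    (hκ : κ ∈ coreEdgesOf A B) : (knotFunc A B hG ha h₁ h₂).core κ = f₁ := by
  rcases κ with i | ⟨i, _ | _⟩
  · exact if_pos (c := i ∈ A) hκ
  · exact if_pos (c := i ∈ B) hκ
  · have hB : i ∈ B := hκ
    funext x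
    simp only [SingleKnotGraph.Func.core, knotFunc, knotEdgeFun, hG.2 i, if_pos hB, h₁.symm]

theorem knotFunc_core_of_notMem (hG : G.IsRegular ℓ) (ha : soliton p a = δ)
    (h₁ : IsCoreProfile p ℓ δ f₁ f₁') (h₂ : IsCoreProfile p ℓ δ f₂ f₂') {κ : CoreEdge P L}
    (hκ : κ ∉ coreEdgesOf A B) : (knotFunc A B hG ha h₁ h₂).core κ = f₂ := by
  rcases κ with i | ⟨i, _ | _⟩
  · exact if_neg (c := i ∈ A) hκ
  · exact if_neg (c := i ∈ B) hκ
  · have hB : i ∉ B := hκ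
    funext x
    simp only [SingleKnotGraph.Func.core, knotFunc, knotEdgeFun, hG.2 i, if_neg hB, h₂.symm]

theorem knotFunc_isBoundState (hp : 2 < p) (hℓ : 0 < ℓ) (hH : 1 ≤ H) (hG : G.IsRegular ℓ)
    (ha : soliton p a = δ) (h₁ : IsCoreProfile p ℓ δ f₁ f₁') (h₂ : IsCoreProfile p ℓ δ f₂ f₂')
    (hflux : H * solitonDeriv p a + (A.card + 2 * B.card : ℕ) * f₁' 0
      + ((P - A.card) + 2 * (L - B.card)) * f₂' 0 = 0) :
    (knotFunc A B hG ha h₁ h₂).IsBoundState p :=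
  ⟨knotFunc_memH1 hp hℓ hG ha h₁ h₂, ⟨.halfLine ⟨0, hH⟩, 0, self_mem_Ici, (soliton_pos hp _).ne'⟩,
    fun _ hη => knotFunc_weak_form hp hℓ hG ha h₁ h₂ hflux hη⟩

end

/-! ### Final estimates and choice of constants -/

theorem eLpNorm_top_le_of_abs_le {f : ℝ → ℝ} {s : Set ℝ} (hs : MeasurableSet s) {C : ℝ}
    (h : ∀ x ∈ s, |f x| ≤ C) : eLpNorm f ⊤ (volume.restrict s) ≤ ENNReal.ofReal C := by
  rw [eLpNorm_exponent_top]
  refine eLpNormEssSup_le_of_ae_bound ?_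
  filter_upwards [ae_restrict_mem hs] with x hx
  exact h x hx

/-- The prefactor is at most 1/2. Inside, the small parts add at most `ε`, and so do the errors of
the `E` bumps. -/
theorem abs_action_sub_le {p ε c E H N δ a₁ a₂ a₃ a₄ : ℝ} (hp : 2 < p) (hε : 0 < ε) (hc : 0 < c)
    (hE : 0 < E) (hH : 0 < H) (hN : 0 ≤ N) (hδ : (H + N) * δ ≤ c * ε) (h₁ : 0 ≤ a₁)
    (h₁' : a₁ ≤ δ / c) (h₂ : 0 ≤ a₂) (h₂' : a₂ ≤ δ / c) (h₃ : |a₃ - a₄| ≤ ε / (1 + E)) :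
    |(1 / 2 - 1 / p) * (H * a₁ + E * a₃ + N * a₂) - E / 2 * ((1 / 2 - 1 / p) * (2 * a₄))| ≤ ε := by
  have i5 : H * (δ / c) + N * (δ / c) ≤ ε := by
    rw [← add_mul, mul_div_assoc', div_le_iff₀ hc]; linarith
  have i6 : E * (ε / (1 + E)) ≤ ε := by
    rw [mul_div_assoc', div_le_iff₀ (by linarith)]; linarith
  have hq0 : 0 ≤ 1 / 2 - 1 / p := by
    have := one_div_le_one_div_of_le two_pos hp.le
    linarith
  have hq1 : 1 / 2 - 1 / p ≤ 1 / 2 := by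
    have : 0 ≤ 1 / p := by positivity
    linarith
  have k1 : (1 / 2 - 1 / p) * (H * a₁ + E * a₃ + N * a₂)
      - E / 2 * ((1 / 2 - 1 / p) * (2 * a₄))
      = (1 / 2 - 1 / p) * (H * a₁ + N * a₂ + E * (a₃ - a₄)) := by ring
  have k2 : |H * a₁ + N * a₂ + E * (a₃ - a₄)| ≤ 2 * ε := by
    have m1 := mul_le_mul_of_nonneg_left h₁' hH.le
    have m2 := mul_le_mul_of_nonneg_left h₂' hN
    have m3 := mul_nonneg hH.le h₁
    have m4 := mul_nonneg hN h₂
    have m5 := mul_le_mul_of_nonneg_left (abs_le.1 h₃).2 hE.le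
    have m6 := mul_le_mul_of_nonneg_left (abs_le.1 h₃).1 hE.le
    rw [abs_le]
    constructor <;> linarith
  rw [k1, abs_mul, abs_of_nonneg hq0]
  have := mul_le_mul hq1 k2 (abs_nonneg _) (by norm_num)
  linarith

end

theorem mainTheorem5 (p : ℝ) (hp : 2 < p) (H P L : ℕ) (hH : 1 ≤ H)
    (A : Finset (Fin P)) (B : Finset (Fin L)) (hE : 0 < A.card + 2 * B.card) :
    ∃ C : ℝ, 0 < C ∧ ∀ ε : ℝ, 0 < ε → ∃ ℓ₀ : ℝ, 0 < ℓ₀ ∧ ∀ ℓ : ℝ, ℓ₀ ≤ ℓ →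
      ∀ G : SingleKnotGraph H P L, G.IsRegular ℓ →
        ∃ v : G.Func, v.IsBoundState p ∧
          (0 < v.vertex ∧ v.vertex < ε) ∧
          (v.CoreSymmetricOn ℓ (coreEdgesOf A B) ∧ v.CoreSymmetricOn ℓ (coreEdgesOf A B)ᶜ) ∧
          (∀ κ ∉ coreEdgesOf A B, StrictAntiOn (v.core κ) (Set.Icc 0 ℓ) ∧
            eLpNorm (v.core κ) ⊤ (volume.restrict (Set.Ioo 0 ℓ)) < ENNReal.ofReal ε) ∧
          (∀ κ ∈ coreEdgesOf A B,
            eLpNorm (fun x => v.core κ x - soliton p (ℓ - x)) ⊤ (volume.restrict (Set.Ioo 0 ℓ))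
              ≤ ENNReal.ofReal (C * ε)) ∧
          (∀ h : Fin H, StrictAntiOn (v.edge (.halfLine h)) (Set.Ici 0)) ∧
          |v.action p - ((A.card + 2 * B.card : ℕ) : ℝ) / 2
              * intervalAction p Set.univ (soliton p)| ≤ C * ε := by
  -- All losses are absorbed in the choice of `δ₁` below, so the constant can be 1.
  refine ⟨1, one_pos, fun ε hε => ?_⟩
  simp only [one_mul]
  have hp0 : 0 < p := by linarith
  have hp2 : 0 < p - 2 := by linarith
  have hc := tailRate_pos hp
  set c := tailRate p
  set E : ℝ := ((A.card + 2 * B.card : ℕ) : ℝ) with hEdef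
  have hE0 : 0 < E := Nat.cast_pos.2 hE
  have hH0 : (0 : ℝ) < H := by exact_mod_cast hH
  set N : ℝ := (P - A.card) + 2 * (L - B.card) with hNdef
  have hN0 : 0 ≤ N := by
    have h1 : (A.card : ℝ) ≤ P := by exact_mod_cast (card_finset_fin_le A)
    have h2 : (B.card : ℝ) ≤ L := by exact_mod_cast (card_finset_fin_le B)
    rw [hNdef]; linarith
  -- The tolerance is divided by `1 + E` because the errors of `E` bumps add up in the action.
  obtain ⟨δ₂, R, hδ₂, hclose⟩ := exists_close_to_soliton (ε := ε / (1 + E)) (b := (H + N) / E) hp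
    (by positivity) (by positivity)
  set δ₁ := min (min (1 / 2) (ε / 2)) (min (min ((p - 2) / (2 * p)) (E / (H + N)))
    (min δ₂ (c * ε / (H + N)))) with hδ₁
  have hδ₁0 : 0 < δ₁ := by positivity
  have d1 : δ₁ ≤ 1 / 2 := (min_le_left _ _).trans (min_le_left _ _)
  have d2 : δ₁ ≤ ε / 2 := (min_le_left _ _).trans (min_le_right _ _)
  have d3 : δ₁ ≤ (p - 2) / (2 * p) :=
    (min_le_right _ _).trans ((min_le_left _ _).trans (min_le_left _ _))
  have d4 : δ₁ ≤ E / (H + N) := (min_le_right _ _).trans ((min_le_left _ _).trans (min_le_right _ _))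
  have d5 : δ₁ ≤ δ₂ := (min_le_right _ _).trans ((min_le_right _ _).trans (min_le_left _ _))
  have d6 : δ₁ ≤ c * ε / (H + N) :=
    (min_le_right _ _).trans ((min_le_right _ _).trans (min_le_right _ _))
  have hHN : 0 < H + N := by linarith
  rw [le_div_iff₀ hHN] at d4 d6
  obtain ⟨ℓ₁, hℓ₁, hshoot⟩ := exists_shooting hp hE0 hH0 hN0 hδ₁0 d1 (by nlinarith)
    (by rw [div_mul_eq_mul_div, div_le_one hE0]; linarith)
  refine ⟨max ℓ₁ R, lt_max_of_lt_left hℓ₁, fun ℓ hℓ G hG => ?_⟩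
  have hℓ0 : 0 < ℓ := hℓ₁.trans_le ((le_max_left _ _).trans hℓ)
  obtain ⟨y, w, Z, W, hy, hZ, hy0, hw0, hZ0, hyδ, hW0, hW0pos, hWℓ, hWpos⟩ :=
    hshoot ℓ ((le_max_left _ _).trans hℓ)
  set δ := y ℓ with hδ
  have hynn := hy.half_nonneg hp hw0
  have hmono := hy.strictMonoOn (a := 0) (b := ℓ) fun t ht => hy.half_pos hp hw0 hy0 t ht.1
  have hδ0 : 0 < δ := hy0.trans_le (hynn ℓ hℓ0.le).2
  have hyle : ∀ t ∈ Icc 0 ℓ, 0 < y t ∧ y t ≤ δ := fun t ht =>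
    ⟨hy0.trans_le (hynn t ht.1).2, hmono.monotoneOn ht ⟨hℓ0.le, le_rfl⟩ ht.2⟩
  have hwδ : w ℓ ≤ δ := hy.half_le hp hw0 hy0.le ℓ hℓ0.le
  have hrefl : ∀ t ∈ Icc 0 ℓ, ℓ - t ∈ Icc 0 ℓ := fun t ht => ⟨by linarith [ht.2], by linarith [ht.1]⟩
  have hWb : W 0 ≤ (H + N) / E * Z 0 := by
    rw [hW0, hZ0]; exact fluxSlope_le hp hE0 hH0 hN0 hδ0.le hwδ
  have hWnn : ∀ t ∈ Icc 0 ℓ, 0 ≤ W t := by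
    intro t ht
    rcases ht.2.eq_or_lt with rfl | h1
    · exact hWℓ.ge
    · exact (hWpos t ⟨ht.1, h1⟩).le
  have hW1 : W 0 ≤ 1 := by
    have : (H + N) / E * Z 0 ≤ 1 := by
      rw [hZ0, div_mul_eq_mul_div, div_le_one hE0]; nlinarith
    linarith
  have hZr := hZ.le_topLevel hp hWnn (by linarith) (by linarith) hW1
  obtain ⟨a, ha0, ha⟩ := exists_soliton_eq hp hδ0 (by linarith)
  have h₁ : IsCoreProfile p ℓ δ Z W := by
    rw [← hZ0]
    exact hZ.isCoreProfile hp (by linarith [one_lt_topLevel hp]) hWℓ fun t ht =>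
      ⟨by linarith [(hZr t ht).1], (hZr t ht).2⟩
  -- The small solution is reversed, as the coordinate on an edge starts at the vertex.
  have h₂ : IsCoreProfile p ℓ δ (fun t => y (ℓ - t)) (fun t => -w (ℓ - t)) := by
    have := (hy.comp_sub_left ℓ).isCoreProfile (ℓ := ℓ) hp (by norm_num) (by simp [hw0]) fun t ht =>
      ⟨(hyle _ (hrefl t ht)).1, by linarith [(hyle _ (hrefl t ht)).2]⟩
    rwa [sub_zero] at this
  -- By `solitonDeriv_eq_sqrt` the half-line slopes are the square-root term of `fluxSlope`, so the
  -- balance is the definition of `W 0`.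
  have hflux : H * solitonDeriv p a + (A.card + 2 * B.card : ℕ) * W 0
      + ((P - A.card) + 2 * (L - B.card)) * (-w (ℓ - 0)) = 0 := by
    rw [← hEdef, ← hNdef, hW0, fluxSlope, solitonDeriv_eq_sqrt hp ha0.le, ha, sub_zero,
      mul_div_cancel₀ _ hE0.ne']
    ring
  obtain ⟨hc1, hc2⟩ := hclose ℓ ((le_max_right _ _).trans hℓ) Z W hZ (by linarith) (by linarith)
    hW0pos hWb hWℓ hWpos
  have hε' : ε / (1 + E) ≤ ε := div_le_self hε.le (by linarith)
  refine ⟨knotFunc A B hG ha h₁ h₂, knotFunc_isBoundState hp hℓ0 hH hG ha h₁ h₂ hflux,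
    ⟨hδ0, show δ < ε by linarith⟩, ⟨fun κ₁ hκ₁ κ₂ hκ₂ => ?_, fun κ₁ hκ₁ κ₂ hκ₂ => ?_⟩,
    fun κ hκ => ?_, fun κ hκ => ?_, fun h => ?_, ?_⟩
  · rw [knotFunc_core_of_mem hG ha h₁ h₂ hκ₁, knotFunc_core_of_mem hG ha h₁ h₂ hκ₂]
    exact eqOn_refl _ _
  · rw [knotFunc_core_of_notMem hG ha h₁ h₂ hκ₁, knotFunc_core_of_notMem hG ha h₁ h₂ hκ₂]
    exact eqOn_refl _ _
  · rw [knotFunc_core_of_notMem hG ha h₁ h₂ hκ]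
    refine ⟨fun s hs t ht hst => hmono (hrefl t ht) (hrefl s hs) (by linarith), ?_⟩
    refine (eLpNorm_top_le_of_abs_le measurableSet_Ioo (C := ε / 2) fun x hx => ?_).trans_lt
      ((ENNReal.ofReal_lt_ofReal_iff hε).2 (by linarith))
    have := hyle _ (hrefl x (Ioo_subset_Icc_self hx))
    rw [abs_of_pos this.1]
    linarith [this.2]
  · rw [knotFunc_core_of_mem hG ha h₁ h₂ hκ]
    exact eLpNorm_top_le_of_abs_le measurableSet_Ioo fun x hx =>
      (hc1 x (Ioo_subset_Icc_self hx)).trans hε'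
  · intro s hs t ht hst
    have hs' : 0 ≤ s := hs
    have ht' : 0 ≤ t := ht
    exact strictAntiOn_soliton hp (show 0 ≤ a + s by linarith) (show 0 ≤ a + t by linarith)
      (by linarith)
  · rw [knotFunc_action hp hℓ0 hG ha h₁ h₂ hflux, intervalAction_soliton hp, ← hEdef, ← hNdef]
    have i1 : ∫ x in Ioi a, soliton p x ^ p ≤ δ / c := by
      have := integral_Ioi_soliton_le hp ha0.le (by rw [ha]; linarith)
      rwa [ha] at this
    have i2 : 0 ≤ ∫ x in Ioi a, soliton p x ^ p :=
      setIntegral_nonneg measurableSet_Ioi fun t _ => Real.rpow_nonneg (soliton_pos hp t).le _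
    have e : ∫ x in (0 : ℝ)..ℓ, y (ℓ - x) ^ p = ∫ x in (0 : ℝ)..ℓ, y x ^ p := by
      rw [intervalIntegral.integral_comp_sub_left (fun t => y t ^ p), sub_self, sub_zero]
    have i3 : ∫ x in (0 : ℝ)..ℓ, y (ℓ - x) ^ p ≤ δ / c := by
      rw [e]
      refine (hy.integral_rpow_le hp le_rfl hℓ0.le fun t ht =>
        ⟨(hyle t ht).1, by linarith [(hyle t ht).2]⟩).trans ?_
      exact div_le_div_of_nonneg_right (by linarith) hc.le
    have i4 : 0 ≤ ∫ x in (0 : ℝ)..ℓ, y (ℓ - x) ^ p :=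
      intervalIntegral.integral_nonneg hℓ0.le fun t ht =>
        Real.rpow_nonneg (hyle _ (hrefl t ht)).1.le _
    exact abs_action_sub_le hp hε hc hE0 hH0 hN0
      ((mul_le_mul_of_nonneg_left hyδ hHN.le).trans (by linarith)) i2 i1 i4 i3 hc2
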